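/- Let $\gamma\subset\mathbb C$ be a smooth Jordan curve, that is, the image of a smooth $2\pi$-periodic map $c:\mathbb R\to\mathbb C$ with nowhere vanishing derivative that is injective on $[0,2\pi)$. Equip $\mathbb C^2$, with coordinates $z=x+iy$ and $w=re^{i\theta}$, with the standard symplectic form $\omega=dx\wedge dy+r\,dr\wedge d\theta$. Let $L=\{(\tfrac{z+w}{2},\tfrac{z-w}{2}) : z,w\in\gamma\}$, and for $\alpha\in\mathbb R$ let $R_\alpha(z,w)=(z,e^{i\alpha}w)$. Let $L_\phi$ be one of the following: (a) $L_\phi=R_\phi(L)$ for a constant $0<\phi\le\pi/2$; or (b) $L_\phi=S_\phi(L)$ for a smooth function $\phi:[0,\infty)\to(0,\pi)$ such that the map $S_\phi:\mathbb C^2\to\mathbb C^2$, $S_\phi(z,w)=(z,e^{i\phi(2|w|)}w)$, is smooth. Let $\epsilon>0$ and let $X=S^1\times(-\epsilon,\epsilon)\times\mathbb R\times\mathbb R$, where $S^1=\mathbb R/2\pi\mathbb Z$, with coordinates $(\theta,s,t_1,t_2)$, symplectic form $\omega_X=d\theta\wedge dt_1+ds\wedge dt_2$ and involution $I(\theta,s,t_1,t_2)=(\theta,-s,t_1,-t_2)$.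 Put $L_0=S^1\times(-\epsilon,\epsilon)\times\{0\}\times\{0\}$, $L_1=S^1\times\{0\}\times\{0\}\times\mathbb R$ and $\Gamma=S^1\times\{0\}\times\{0\}\times\{0\}$. Then there exist an open neighborhood $\mathcal N(\Gamma)$ of $\Gamma$ in $X$ with $I(\mathcal N(\Gamma))=\mathcal N(\Gamma)$, an open neighborhood $\mathcal N(\gamma)$ of $\gamma\times\{0\}$ in $\mathbb C^2$, and a symplectomorphism $\Psi:\mathcal N(\Gamma)\to\mathcal N(\gamma)$ (a smooth diffeomorphism with $\Psi^*\omega=\omega_X$) such that 1. $\Psi(\Gamma)=\gamma\times\{0\}$, 2. $\Psi(L_0\cap\mathcal N(\Gamma))=L\cap\mathcal N(\gamma)$, 3. $R_\pi\circ\Psi=\Psi\circ I$ on $\mathcal N(\Gamma)$, and 4. $\Psi(L_1\cap\mathcal N(\Gamma))=L_\phi\cap\mathcal N(\gamma)$. -/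

import Mathlib

open scoped Manifold ContDiff

noncomputable section

namespace PegModel

/-! ### The plane curve and the Lagrangian tori in `ℂ²` -/

/-- A smooth Jordan curve in the plane: the image of a smooth, regular, `2π`-periodic
parametrization that is injective on a period. -/
def IsSmoothJordanCurve (γ : Set ℂ) : Prop :=
  ∃ c : ℝ → ℂ, ContDiff ℝ ∞ c ∧ Function.Periodic c (2 * Real.pi) ∧
    (∀ t, deriv c t ≠ 0) ∧ Set.InjOn c (Set.Ico 0 (2 * Real.pi)) ∧ Set.range c = γ

/-- The linear map `l (z, w) = ((z + w) / 2, (z - w) / 2)`. -/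
def midDiff (p : ℂ × ℂ) : ℂ × ℂ := ((p.1 + p.2) / 2, (p.1 - p.2) / 2)

/-- The torus `L = l (γ × γ)`. -/
def torus (γ : Set ℂ) : Set (ℂ × ℂ) := midDiff '' (γ ×ˢ γ)

/-- The rotation `R_φ : (z, r, θ) ↦ (z, r, θ + φ)`, where `w = r e^{iθ}`. -/
def rotation (φ : ℝ) (p : ℂ × ℂ) : ℂ × ℂ := (p.1, Complex.exp (φ * Complex.I) * p.2)

/-- The twist `S_φ : (z, r, θ) ↦ (z, r, θ + φ (2 r))`, where `w = r e^{iθ}`. -/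
def twist (φ : ℝ → ℝ) (p : ℂ × ℂ) : ℂ × ℂ :=
  (p.1, Complex.exp (φ (2 * ‖p.2‖) * Complex.I) * p.2)

/-- The standard symplectic form `dx ∧ dy + du ∧ dv` on `ℂ²`, with `z = x + i y` and
`w = u + i v`; in polar coordinates `du ∧ dv = r dr ∧ dθ`. -/
def stdForm (a b : ℂ × ℂ) : ℝ :=
  (a.1.re * b.1.im - a.1.im * b.1.re) + (a.2.re * b.2.im - a.2.im * b.2.re)

/-! ### The linear model -/

/-- The manifold `S¹ × ℝ × ℝ × ℝ`, with coordinates `(θ, s, t₁, t₂)`;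
the point of `Circle` with angular coordinate `θ` is `e^{iθ}`. -/
abbrev Ambient : Type := Circle × (ℝ × ℝ × ℝ)

/-- The model with corners of `S¹ × ℝ × ℝ × ℝ`. -/
abbrev ambientModel :
    ModelWithCorners ℝ (EuclideanSpace ℝ (Fin 1) × (ℝ × ℝ × ℝ))
      (ModelProd (EuclideanSpace ℝ (Fin 1)) (ℝ × ℝ × ℝ)) :=
  (𝓡 1).prod 𝓘(ℝ, ℝ × ℝ × ℝ)

/-- `X = S¹ × (-ε, ε) × ℝ × ℝ`, an open subset of `S¹ × ℝ × ℝ × ℝ`. -/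
def modelX (ε : ℝ) : Set Ambient := {p | p.2.1 ∈ Set.Ioo (-ε) ε}

/-- The coordinate `s`. -/
def coordS (p : Ambient) : ℝ := p.2.1

/-- The coordinate `t₁`. -/
def coordT₁ (p : Ambient) : ℝ := p.2.2.1

/-- The coordinate `t₂`. -/
def coordT₂ (p : Ambient) : ℝ := p.2.2.2

/-- The differential at `p` of a real-valued function on `S¹ × ℝ × ℝ × ℝ`. -/
def differential (f : Ambient → ℝ) (p : Ambient) (v : TangentSpace ambientModel p) : ℝ :=
  mfderiv ambientModel 𝓘(ℝ, ℝ) f p v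

/-- The differential `dζ` of the inclusion `ζ = e^{iθ}` of the circle factor in `ℂ`. -/
def dZeta (p : Ambient) (v : TangentSpace ambientModel p) : ℂ :=
  mfderiv ambientModel 𝓘(ℝ, ℂ) (fun q : Ambient => (q.1 : ℂ)) p v

/-- The angular form `dθ`, which is `Im (conj ζ dζ)` for `ζ = e^{iθ}` on the unit circle. -/
def dTheta (p : Ambient) (v : TangentSpace ambientModel p) : ℝ :=
  ((starRingEnd ℂ) (p.1 : ℂ) * dZeta p v).im

/-- The symplectic form `ω_X = dθ ∧ dt₁ + ds ∧ dt₂`. -/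
def modelForm (p : Ambient) (v w : TangentSpace ambientModel p) : ℝ :=
  (dTheta p v * differential coordT₁ p w - dTheta p w * differential coordT₁ p v) +
    (differential coordS p v * differential coordT₂ p w -
      differential coordS p w * differential coordT₂ p v)

/-- The involution `I (θ, s, t₁, t₂) = (θ, -s, t₁, -t₂)`. -/
def involution (p : Ambient) : Ambient := (p.1, -p.2.1, p.2.2.1, -p.2.2.2)

/-- `L₀ = S¹ × (-ε, ε) × {0} × {0}`. -/
def modelL₀ (ε : ℝ) : Set Ambient := {p | p.2.1 ∈ Set.Ioo (-ε) ε ∧ p.2.2.1 = 0 ∧ p.2.2.2 = 0}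

/-- `L₁ = S¹ × {0} × {0} × ℝ`. -/
def modelL₁ : Set Ambient := {p | p.2.1 = 0 ∧ p.2.2.1 = 0}

/-- `Γ = S¹ × {0} × {0} × {0}`. -/
def coreCircle : Set Ambient := {p | p.2.1 = 0 ∧ p.2.2.1 = 0 ∧ p.2.2.2 = 0}

/-- A symplectomorphism from the open set `Ψ.source` of `S¹ × ℝ × ℝ × ℝ` onto the open set
`Ψ.target` of `ℂ²`: a diffeomorphism that pulls the standard form back to `ω_X`. -/
structure IsSymplectomorphism (Ψ : OpenPartialHomeomorph Ambient (ℂ × ℂ)) : Prop where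
  smooth : ContMDiffOn ambientModel 𝓘(ℝ, ℂ × ℂ) ∞ Ψ Ψ.source
  smooth_symm : ContMDiffOn 𝓘(ℝ, ℂ × ℂ) ambientModel ∞ Ψ.symm Ψ.target
  pullback : ∀ p ∈ Ψ.source, ∀ v w : TangentSpace ambientModel p,
    stdForm (mfderiv ambientModel 𝓘(ℝ, ℂ × ℂ) Ψ p v)
      (mfderiv ambientModel 𝓘(ℝ, ℂ × ℂ) Ψ p w) = modelForm p v w

end PegModel

end

noncomputable section

namespace PegModel

/-! The torus `L` is a linear image of `γ × γ`, so Darboux coordinates near `γ × {0}` can be built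
from the plane. Put `a = |c'|²` and `κ = wedge c'' c'`. The collar `c + u • (i c')` has Jacobian
`u_t (a + κ u)`, which is `1` when `κ u² / 2 + a u = t`; the root, rationalised so that `κ = 0` is
allowed, is `collarHeight`. Taking collar points at `(θ ± s, t₁ ± t₂)` and applying `midDiff` gives
`tubeMap`: symplectic, with `L` at `t₁ = t₂ = 0`, and with `I` turned into `R_π` because `I` swaps
the two points.

At `w = 0` the twist turns the fibre by an angle with nonzero sine. Hence `L_φ` meets `L` cleanly
along `γ × {0}`, and near it `L_φ` is a graph `s = S(θ, t₂)`, `t₁ = A(θ, t₂)`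
(`exists_isTwistedGraph`). That the graph is Lagrangian means `S_θ + A_{t₂} = 0`, which is exactly
the condition for the shear adding `(S, A)` to `(s, t₁)` to be symplectic. The shear carries `L₁` to
the graph, is the identity on `t₂ = 0` and so keeps `L₀`, and commutes with `I` since `S` is odd and
`A` even in `t₂`. Thus `tubeMap` after the shear straightens both tori at once
(`exists_isAdaptedLift`).

By periodicity this map descends to the circle; it is injective near the compact core, hence a
symplectomorphism onto its image (`exists_symplectomorphism`). For the images of `L₀` and `L₁` to be
all of the tori in the target, no remote part of a torus may come close to `γ × {0}`. Only pairs of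
equal points of the curve lie there, and compactness does the rest (`exists_isOpen_forall_mem`). -/

/-! ### Area-preserving collar of a regular loop -/

/-- The area form of the plane. -/
def wedge (a b : ℂ) : ℝ := a.re * b.im - a.im * b.re

lemma stdForm_eq (a b : ℂ × ℂ) : stdForm a b = wedge a.1 b.1 + wedge a.2 b.2 := rfl

/-- A smooth regular `2π`-periodic parametrization of a Jordan curve. -/
structure IsRegularLoop (c : ℝ → ℂ) : Prop where
  contDiff : ContDiff ℝ ∞ c
  periodic : Function.Periodic c (2 * Real.pi)
  deriv_ne_zero : ∀ t, deriv c t ≠ 0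
  injOn : Set.InjOn c (Set.Ico 0 (2 * Real.pi))

/-- The squared Jacobian of the collar. -/
def collarDisc (c : ℝ → ℂ) (p : ℝ × ℝ) : ℝ :=
  Complex.normSq (deriv c p.1) ^ 2 + 2 * wedge (deriv (deriv c) p.1) (deriv c p.1) * p.2

/-- The height over the curve, in multiples of the rotated velocity. -/
def collarHeight (c : ℝ → ℂ) (p : ℝ × ℝ) : ℝ :=
  2 * p.2 / (Complex.normSq (deriv c p.1) + √(collarDisc c p))

/-- The area-preserving collar of the curve parametrized by `c`. -/
def collar (c : ℝ → ℂ) (p : ℝ × ℝ) : ℂ :=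
  c p.1 + collarHeight c p • (Complex.I * deriv c p.1)

namespace IsRegularLoop

variable {c : ℝ → ℂ}

lemma contDiff_deriv (hc : IsRegularLoop c) : ContDiff ℝ ∞ (deriv c) :=
  ((contDiff_infty_iff_deriv (𝕜 := ℝ)).1 hc.contDiff).2

lemma contDiff_deriv_deriv (hc : IsRegularLoop c) : ContDiff ℝ ∞ (deriv (deriv c)) :=
  ((contDiff_infty_iff_deriv (𝕜 := ℝ)).1 hc.contDiff_deriv).2

lemma normSq_pos (hc : IsRegularLoop c) (t : ℝ) : 0 < Complex.normSq (deriv c t) :=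
  Complex.normSq_pos.2 (hc.deriv_ne_zero t)

lemma contDiff_collarDisc (hc : IsRegularLoop c) : ContDiff ℝ ∞ (collarDisc c) := by
  have h1 : ContDiff ℝ ∞ fun p : ℝ × ℝ => deriv c p.1 := hc.contDiff_deriv.comp contDiff_fst
  have h2 : ContDiff ℝ ∞ fun p : ℝ × ℝ => deriv (deriv c) p.1 :=
    hc.contDiff_deriv_deriv.comp contDiff_fst
  have r {f : ℝ × ℝ → ℂ} (h : ContDiff ℝ ∞ f) : ContDiff ℝ ∞ fun p => (f p).re :=
    Complex.reCLM.contDiff.comp h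
  have i {f : ℝ × ℝ → ℂ} (h : ContDiff ℝ ∞ f) : ContDiff ℝ ∞ fun p => (f p).im :=
    Complex.imCLM.contDiff.comp h
  unfold collarDisc wedge
  simp only [Complex.normSq_apply]
  exact ((((r h1).mul (r h1)).add ((i h1).mul (i h1))).pow 2).add
    ((contDiff_const.mul (((r h2).mul (i h1)).sub ((i h2).mul (r h1)))).mul contDiff_snd)

lemma contDiffAt_collarHeight (hc : IsRegularLoop c) {p : ℝ × ℝ} (hp : 0 < collarDisc c p) :
    ContDiffAt ℝ ∞ (collarHeight c) p := by
  have h1 : ContDiff ℝ ∞ fun p : ℝ × ℝ => deriv c p.1 := hc.contDiff_deriv.comp contDiff_fst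
  have hn : ContDiff ℝ ∞ fun p : ℝ × ℝ => Complex.normSq (deriv c p.1) := by
    simp only [Complex.normSq_apply]
    have hr := Complex.reCLM.contDiff.comp h1
    have hi := Complex.imCLM.contDiff.comp h1
    exact (hr.mul hr).add (hi.mul hi)
  refine (contDiff_const.mul contDiff_snd).contDiffAt.div
    (hn.contDiffAt.add (hc.contDiff_collarDisc.contDiffAt.sqrt hp.ne')) ?_
  have := hc.normSq_pos p.1
  positivity

lemma contDiffAt_collar (hc : IsRegularLoop c) {p : ℝ × ℝ} (hp : 0 < collarDisc c p) :
    ContDiffAt ℝ ∞ (collar c) p :=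
  (hc.contDiff.comp contDiff_fst).contDiffAt.add ((hc.contDiffAt_collarHeight hp).smul
    (contDiff_const.mul (hc.contDiff_deriv.comp contDiff_fst)).contDiffAt)

/-- The height solves the quadratic equation that makes the collar area-preserving. -/
lemma sqrt_collarDisc (hc : IsRegularLoop c) {p : ℝ × ℝ} (hp : 0 < collarDisc c p) :
    √(collarDisc c p) = Complex.normSq (deriv c p.1) +
      collarHeight c p * wedge (deriv (deriv c) p.1) (deriv c p.1) := by
  have ha := hc.normSq_pos p.1
  have hS : 0 < √(collarDisc c p) := Real.sqrt_pos.2 hp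
  have hsq : √(collarDisc c p) ^ 2 = Complex.normSq (deriv c p.1) ^ 2 +
      2 * wedge (deriv (deriv c) p.1) (deriv c p.1) * p.2 := Real.sq_sqrt hp.le
  rw [collarHeight]
  set S := √(collarDisc c p)
  field_simp
  linear_combination hsq

/-- Differentiating `κ u² / 2 + a u = t` in `t` gives `u_t (a + κ u) = 1`, and the second factor is
the square root by `sqrt_collarDisc`. -/
lemma fderiv_collarHeight_zero_one (hc : IsRegularLoop c) {p : ℝ × ℝ} (hp : 0 < collarDisc c p) :
    fderiv ℝ (collarHeight c) p (0, 1) * √(collarDisc c p) = 1 := by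
  have hd := ((hc.contDiffAt_collarHeight hp).differentiableAt (by simp)).hasFDerivAt
  have hl : HasDerivAt (fun t : ℝ => (p.1, t)) (0, 1) p.2 :=
    (hasDerivAt_const _ _).prodMk (hasDerivAt_id _)
  have h1 : HasDerivAt (fun t : ℝ => collarHeight c (p.1, t))
      (fderiv ℝ (collarHeight c) p (0, 1)) p.2 :=
    HasFDerivAt.comp_hasDerivAt (f := fun t : ℝ => (p.1, t)) p.2 hd hl
  have ha := hc.normSq_pos p.1
  have hS : 0 < √(collarDisc c p) := Real.sqrt_pos.2 hp
  have h2 : HasDerivAt (fun t : ℝ => collarDisc c (p.1, t))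
      (2 * wedge (deriv (deriv c) p.1) (deriv c p.1)) p.2 := by
    simpa [collarDisc] using ((hasDerivAt_id p.2).const_mul
      (2 * wedge (deriv (deriv c) p.1) (deriv c p.1))).const_add
        (Complex.normSq (deriv c p.1) ^ 2)
  have h3 := ((hasDerivAt_id p.2).const_mul 2).div
    ((h2.sqrt (by simpa using hp.ne')).const_add (Complex.normSq (deriv c p.1)))
    (by simp only [Prod.mk.eta]; positivity)
  rw [h1.unique h3]
  have hsq : √(collarDisc c p) ^ 2 = Complex.normSq (deriv c p.1) ^ 2 +
      2 * wedge (deriv (deriv c) p.1) (deriv c p.1) * p.2 := Real.sq_sqrt hp.le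
  simp only [Prod.mk.eta, id]
  set S := √(collarDisc c p)
  field_simp
  linear_combination hsq

lemma fderiv_collar (hc : IsRegularLoop c) {p : ℝ × ℝ} (hp : 0 < collarDisc c p) (v : ℝ × ℝ) :
    fderiv ℝ (collar c) p v =
      v.1 • (deriv c p.1 + collarHeight c p • (Complex.I * deriv (deriv c) p.1)) +
      fderiv ℝ (collarHeight c) p v • (Complex.I * deriv c p.1) := by
  have hd := ((hc.contDiffAt_collarHeight hp).differentiableAt (by simp)).hasFDerivAt
  have h1 : HasFDerivAt (fun p : ℝ × ℝ => c p.1) _ p :=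
    HasFDerivAt.comp (f := Prod.fst) p
      ((hc.contDiff.differentiable (by simp)) p.1).hasDerivAt.hasFDerivAt hasFDerivAt_fst
  have h2 : HasFDerivAt (fun p : ℝ × ℝ => deriv c p.1) _ p :=
    HasFDerivAt.comp (f := Prod.fst) p
      ((hc.contDiff_deriv.differentiable (by simp)) p.1).hasDerivAt.hasFDerivAt hasFDerivAt_fst
  have h3 := h1.add (hd.smul (h2.const_mul Complex.I))
  have h4 : HasFDerivAt (collar c) _ p := h3
  rw [h4.fderiv]
  simp
  ring

/-- The collar is area-preserving. -/
lemma wedge_fderiv_collar (hc : IsRegularLoop c) {p : ℝ × ℝ} (hp : 0 < collarDisc c p) (v w :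
    ℝ × ℝ) :
    wedge (fderiv ℝ (collar c) p v) (fderiv ℝ (collar c) p w) = v.1 * w.2 - w.1 * v.2 := by
  have hS := hc.sqrt_collarDisc hp
  have hu := hc.fderiv_collarHeight_zero_one hp
  have hlin (v : ℝ × ℝ) : fderiv ℝ (collarHeight c) p v =
      v.1 * fderiv ℝ (collarHeight c) p (1, 0) + v.2 * fderiv ℝ (collarHeight c) p (0, 1) := by
    conv_lhs => rw [show v = v.1 • (1, 0) + v.2 • (0, 1) by ext <;> simp]
    rw [map_add, map_smul, map_smul]; rfl
  rw [hc.fderiv_collar hp, hc.fderiv_collar hp, hlin v, hlin w]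
  rw [hS] at hu
  simp only [wedge, Complex.normSq_apply] at hu ⊢
  simp
  -- The `θ`-derivative of the height only adds a multiple of `i c'`, parallel to the `t`-derivative
  -- of the collar, so it cancels and `u_t (a + κ u)` remains.
  linear_combination (v.1 * w.2 - w.1 * v.2) * hu

@[simp] lemma collarHeight_zero (θ : ℝ) : collarHeight c (θ, 0) = 0 := by simp [collarHeight]

@[simp] lemma collar_zero (θ : ℝ) : collar c (θ, 0) = c θ := by simp [collar]

lemma collarDisc_zero (hc : IsRegularLoop c) (θ : ℝ) : 0 < collarDisc c (θ, 0) := by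
  have := hc.normSq_pos θ
  simp only [collarDisc, mul_zero, add_zero]
  positivity

/-- The height vanishes along the curve, so of its differential only `u_t = 1 / a` survives. -/
lemma fderiv_collar_zero (hc : IsRegularLoop c) (θ : ℝ) (v : ℝ × ℝ) :
    fderiv ℝ (collar c) (θ, 0) v =
      v.1 • deriv c θ + (v.2 / Complex.normSq (deriv c θ)) • (Complex.I * deriv c θ) := by
  have hp := hc.collarDisc_zero θ
  have ha := hc.normSq_pos θ
  have hd := ((hc.contDiffAt_collarHeight hp).differentiableAt (by simp)).hasFDerivAt
  have hl : HasDerivAt (fun t : ℝ => (t, (0 : ℝ))) (1, 0) θ :=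
    (hasDerivAt_id _).prodMk (hasDerivAt_const _ _)
  have h1 : HasDerivAt (fun t : ℝ => collarHeight c (t, 0))
      (fderiv ℝ (collarHeight c) (θ, 0) (1, 0)) θ :=
    HasFDerivAt.comp_hasDerivAt (f := fun t : ℝ => (t, (0 : ℝ))) θ hd hl
  have h0 : fderiv ℝ (collarHeight c) (θ, 0) (1, 0) = 0 := by
    simp only [collarHeight_zero] at h1
    exact h1.unique (hasDerivAt_const _ _)
  have hu := hc.fderiv_collarHeight_zero_one hp
  rw [hc.sqrt_collarDisc hp] at hu
  simp only [collarHeight_zero, zero_mul, add_zero] at hu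
  have h2 : fderiv ℝ (collarHeight c) (θ, 0) v = v.2 / Complex.normSq (deriv c θ) := by
    conv_lhs => rw [show v = v.1 • (1, 0) + v.2 • (0, 1) by ext <;> simp]
    rw [map_add, map_smul, map_smul, h0, eq_div_iff ha.ne']
    simp only [smul_eq_mul, mul_zero, zero_add]
    linear_combination v.2 * hu
  rw [hc.fderiv_collar hp, h2]
  simp

lemma periodic_deriv {f : ℝ → ℂ} {T : ℝ} (hf : Function.Periodic f T) :
    Function.Periodic (deriv f) T := by
  intro x
  rw [← deriv_comp_add_const]
  congr 1
  exact funext hf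

lemma collarDisc_add_period (hc : IsRegularLoop c) (θ t : ℝ) :
    collarDisc c (θ + 2 * Real.pi, t) = collarDisc c (θ, t) := by
  have h1 := periodic_deriv hc.periodic
  simp [collarDisc, h1 θ, periodic_deriv h1 θ]

lemma collar_add_period (hc : IsRegularLoop c) (θ t : ℝ) :
    collar c (θ + 2 * Real.pi, t) = collar c (θ, t) := by
  have h1 := periodic_deriv hc.periodic
  simp [collar, collarHeight, hc.collarDisc_add_period, h1 θ, hc.periodic θ]

end IsRegularLoop

/-! ### Darboux coordinates around the torus -/

/-- The symplectic form `dθ ∧ dt₁ + ds ∧ dt₂` in the coordinates `(θ, s, t₁, t₂)`. -/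
def flatForm (v w : ℝ × ℝ × ℝ × ℝ) : ℝ :=
  (v.1 * w.2.2.1 - w.1 * v.2.2.1) + (v.2.1 * w.2.2.2 - w.2.1 * v.2.2.2)

/-- `midDiff` as a continuous linear map. -/
def midDiffCLM : ℂ × ℂ →L[ℝ] ℂ × ℂ :=
  (((1 / 2 : ℝ) • (ContinuousLinearMap.fst ℝ ℂ ℂ + ContinuousLinearMap.snd ℝ ℂ ℂ))).prod
    ((1 / 2 : ℝ) • (ContinuousLinearMap.fst ℝ ℂ ℂ - ContinuousLinearMap.snd ℝ ℂ ℂ))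

@[simp] lemma midDiffCLM_apply (p : ℂ × ℂ) : midDiffCLM p = midDiff p := by
  ext <;> simp [midDiffCLM, midDiff] <;> ring

/-- The factor `1 / 2` is compensated by the sum and difference coordinates, which double
`flatForm`. -/
lemma stdForm_midDiff (a b : ℂ × ℂ) :
    stdForm (midDiff a) (midDiff b) = (wedge a.1 b.1 + wedge a.2 b.2) / 2 := by
  simp [stdForm, midDiff, wedge]
  ring

/-- The sum of the first and second, and of the third and fourth coordinates. -/
def sumCLM : ℝ × ℝ × ℝ × ℝ →L[ℝ] ℝ × ℝ :=
  (LinearMap.toContinuousLinearMap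
    { toFun := fun p => (p.1 + p.2.1, p.2.2.1 + p.2.2.2)
      map_add' := fun p q => by ext <;> simp <;> ring
      map_smul' := fun r p => by ext <;> simp <;> ring })

/-- The difference of the first and second, and of the third and fourth coordinates. -/
def diffCLM : ℝ × ℝ × ℝ × ℝ →L[ℝ] ℝ × ℝ :=
  (LinearMap.toContinuousLinearMap
    { toFun := fun p => (p.1 - p.2.1, p.2.2.1 - p.2.2.2)
      map_add' := fun p q => by ext <;> simp <;> ring
      map_smul' := fun r p => by ext <;> simp <;> ring })

@[simp] lemma sumCLM_apply (p : ℝ × ℝ × ℝ × ℝ) :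
    sumCLM p = (p.1 + p.2.1, p.2.2.1 + p.2.2.2) := rfl

@[simp] lemma diffCLM_apply (p : ℝ × ℝ × ℝ × ℝ) :
    diffCLM p = (p.1 - p.2.1, p.2.2.1 - p.2.2.2) := rfl

/-- Darboux coordinates `(θ, s, t₁, t₂)` around `γ × {0}` in which the torus is `t₁ = t₂ = 0`. -/
def tubeMap (c : ℝ → ℂ) (p : ℝ × ℝ × ℝ × ℝ) : ℂ × ℂ :=
  midDiffCLM (collar c (sumCLM p), collar c (diffCLM p))

/-- The set on which `tubeMap` is smooth and symplectic. -/
def tubeDomain (c : ℝ → ℂ) : Set (ℝ × ℝ × ℝ × ℝ) :=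
  {p | 0 < collarDisc c (sumCLM p) ∧ 0 < collarDisc c (diffCLM p)}

/-- The sign changes swap the two collar points, which keeps their midpoint and negates their
half-difference. -/
lemma tubeMap_reflect (c : ℝ → ℂ) (θ s t₁ t₂ : ℝ) :
    tubeMap c (θ, -s, t₁, -t₂) = ((tubeMap c (θ, s, t₁, t₂)).1, -(tubeMap c (θ, s, t₁, t₂)).2) := by
  simp only [tubeMap, midDiffCLM_apply, midDiff, sumCLM_apply, diffCLM_apply, sub_neg_eq_add,
    ← sub_eq_add_neg, Prod.mk.injEq]
  constructor <;> ring

@[simp] lemma tubeMap_zero (c : ℝ → ℂ) (θ s : ℝ) :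
    tubeMap c (θ, s, 0, 0) = midDiff (c (θ + s), c (θ - s)) := by
  simp [tubeMap]

namespace IsRegularLoop

variable {c : ℝ → ℂ}

lemma isOpen_tubeDomain (hc : IsRegularLoop c) : IsOpen (tubeDomain c) :=
  (isOpen_lt continuous_const (hc.contDiff_collarDisc.continuous.comp sumCLM.continuous)).inter
    (isOpen_lt continuous_const (hc.contDiff_collarDisc.continuous.comp diffCLM.continuous))

lemma mem_tubeDomain_zero (hc : IsRegularLoop c) (θ s : ℝ) : (θ, s, 0, 0) ∈ tubeDomain c := by
  simp [tubeDomain, hc.collarDisc_zero]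

lemma contDiffAt_tubeMap (hc : IsRegularLoop c) {p : ℝ × ℝ × ℝ × ℝ} (hp : p ∈ tubeDomain c) :
    ContDiffAt ℝ ∞ (tubeMap c) p :=
  midDiffCLM.contDiff.contDiffAt.comp p
    (((hc.contDiffAt_collar hp.1).comp p sumCLM.contDiff.contDiffAt).prodMk
      ((hc.contDiffAt_collar hp.2).comp p diffCLM.contDiff.contDiffAt))

lemma fderiv_tubeMap (hc : IsRegularLoop c) {p : ℝ × ℝ × ℝ × ℝ} (hp : p ∈ tubeDomain c) (v :
    ℝ × ℝ × ℝ × ℝ) :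
    fderiv ℝ (tubeMap c) p v = midDiff (fderiv ℝ (collar c) (sumCLM p) (sumCLM v),
      fderiv ℝ (collar c) (diffCLM p) (diffCLM v)) := by
  have h1 := ((hc.contDiffAt_collar hp.1).differentiableAt (by simp)).hasFDerivAt.comp p
    sumCLM.hasFDerivAt
  have h2 := ((hc.contDiffAt_collar hp.2).differentiableAt (by simp)).hasFDerivAt.comp p
    diffCLM.hasFDerivAt
  have h3 : HasFDerivAt (tubeMap c) _ p := midDiffCLM.hasFDerivAt.comp p (h1.prodMk h2)
  rw [h3.fderiv, ← midDiffCLM_apply]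
  rfl

lemma stdForm_fderiv_tubeMap (hc : IsRegularLoop c) {p : ℝ × ℝ × ℝ × ℝ} (hp : p ∈ tubeDomain c)
    (v w : ℝ × ℝ × ℝ × ℝ) :
    stdForm (fderiv ℝ (tubeMap c) p v) (fderiv ℝ (tubeMap c) p w) = flatForm v w := by
  rw [hc.fderiv_tubeMap hp, hc.fderiv_tubeMap hp, stdForm_midDiff, hc.wedge_fderiv_collar hp.1,
    hc.wedge_fderiv_collar hp.2]
  simp only [flatForm, sumCLM_apply, diffCLM_apply]
  ring

lemma tubeMap_add_period (hc : IsRegularLoop c) (θ : ℝ) (x : ℝ × ℝ × ℝ) :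
    tubeMap c (θ + 2 * Real.pi, x) = tubeMap c (θ, x) := by
  simp only [tubeMap, sumCLM_apply, diffCLM_apply, add_right_comm θ, add_sub_right_comm θ,
    hc.collar_add_period]

lemma mem_tubeDomain_add_period (hc : IsRegularLoop c) (θ : ℝ) (x : ℝ × ℝ × ℝ) :
    (θ + 2 * Real.pi, x) ∈ tubeDomain c ↔ (θ, x) ∈ tubeDomain c := by
  simp only [tubeDomain, Set.mem_ofPred_eq, sumCLM_apply, diffCLM_apply, add_right_comm θ,
    add_sub_right_comm θ, hc.collarDisc_add_period]

lemma fderiv_tubeMap_zero (hc : IsRegularLoop c) (θ : ℝ) (v : ℝ × ℝ × ℝ × ℝ) :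
    fderiv ℝ (tubeMap c) (θ, 0, 0, 0) v =
      (v.1 • deriv c θ + (v.2.2.1 / Complex.normSq (deriv c θ)) • (Complex.I * deriv c θ),
       v.2.1 • deriv c θ + (v.2.2.2 / Complex.normSq (deriv c θ)) • (Complex.I * deriv c θ)) := by
  have h1 : sumCLM (θ, 0, 0, 0) = (θ, 0) := by simp
  have h2 : diffCLM (θ, 0, 0, 0) = (θ, 0) := by simp
  rw [hc.fderiv_tubeMap (hc.mem_tubeDomain_zero θ 0), h1, h2, hc.fderiv_collar_zero,
    hc.fderiv_collar_zero]
  ext1 <;> simp [midDiff] <;> ring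

end IsRegularLoop

/-! ### The twisted torus -/

/-- The properties of the map `w ↦ e^{iφ} w` of the second factor that are used below. -/
structure IsFibreTwist (T : ℂ → ℂ) : Prop where
  contDiff : ContDiff ℝ ∞ T
  odd : ∀ w, T (-w) = -T w
  eq_zero : ∀ w, T w = 0 → w = 0
  area : ∀ w h k, wedge (fderiv ℝ T w h) (fderiv ℝ T w k) = wedge h k
  fderiv_zero : ∃ e : ℂ, e.im ≠ 0 ∧ ∀ h, fderiv ℝ T 0 h = e * h

lemma IsFibreTwist.map_zero {T : ℂ → ℂ} (hT : IsFibreTwist T) : T 0 = 0 := by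
  have h := hT.odd 0
  rw [neg_zero] at h
  exact self_eq_neg.1 h

lemma wedge_mul_left (e a b : ℂ) : wedge (e * a) (e * b) = Complex.normSq e * wedge a b := by
  simp [wedge, Complex.normSq_apply]
  ring

lemma isFibreTwist_rotation {φ : ℝ} (h : Real.sin φ ≠ 0) :
    IsFibreTwist fun w => Complex.exp (φ * Complex.I) * w := by
  have hd (w h : ℂ) : fderiv ℝ (fun w => Complex.exp (φ * Complex.I) * w) w h =
      Complex.exp (φ * Complex.I) * h := by
    have h' : HasFDerivAt (fun w => Complex.exp (φ * Complex.I) * w) _ w :=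
      (hasFDerivAt_id (𝕜 := ℝ) w).const_mul (Complex.exp (φ * Complex.I))
    rw [h'.fderiv]
    simp
  refine ⟨contDiff_const.mul contDiff_id, by simp, by simp, fun w h k => ?_,
    Complex.exp (φ * Complex.I), by simpa [Complex.exp_ofReal_mul_I_im] using h, fun h => hd 0 h⟩
  rw [hd, hd, wedge_mul_left, Complex.normSq_eq_norm_sq, Complex.norm_exp_ofReal_mul_I]
  simp

/-- Since the angle depends only on `‖w‖`, the differential away from `0` is, up to a rotation, `h +
l ⟪w, h⟫ i w`, and the two cross terms in the area form cancel. The origin, where the norm is not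
differentiable, is treated separately. -/
lemma isFibreTwist_twist {φ : ℝ → ℝ} (hφ : ContDiffOn ℝ ∞ φ (Set.Ici 0))
    (hs : Real.sin (φ 0) ≠ 0) (ht : ContDiff ℝ ∞ (twist φ)) :
    IsFibreTwist fun w => Complex.exp (φ (2 * ‖w‖) * Complex.I) * w := by
  set T : ℂ → ℂ := fun w => Complex.exp (φ (2 * ‖w‖) * Complex.I) * w with hT
  have hsm : ContDiff ℝ ∞ T :=
    contDiff_snd.comp (ht.comp ((contDiff_const (c := (0 : ℂ))).prodMk contDiff_id))
  have h0 (h : ℂ) : fderiv ℝ T 0 h = Complex.exp (φ 0 * Complex.I) * h := by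
    have hd : HasFDerivAt T (fderiv ℝ T 0) 0 := (hsm.differentiable (by simp) 0).hasFDerivAt
    have hl : HasDerivAt (fun r : ℝ => r • h) h 0 := by
      simpa using (hasDerivAt_id (0 : ℝ)).smul_const h
    have h1 : HasDerivAt (fun r : ℝ => T (r • h)) (fderiv ℝ T 0 h) 0 :=
      HasFDerivAt.comp_hasDerivAt (f := fun r : ℝ => r • h) (l := T) (l' := fderiv ℝ T 0) 0
        (by simpa using hd) hl
    -- The derivative exists by `hsm`, so right-hand slopes determine it. For `r > 0` the slope is
    -- exactly `e^{iφ(2r‖h‖)} h`, and continuity of `φ` on `[0, ∞)` gives the limit.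
    have h2 := h1.hasDerivWithinAt (s := Set.Ioi 0)
    rw [hasDerivWithinAt_iff_tendsto_slope' (by simp)] at h2
    refine tendsto_nhds_unique h2 ?_
    have hm : Filter.Tendsto (fun r : ℝ => 2 * (r * ‖h‖)) (nhdsWithin 0 (Set.Ioi 0))
        (nhdsWithin 0 (Set.Ici 0)) := by
      refine tendsto_nhdsWithin_iff.2 ⟨?_, ?_⟩
      · have : Continuous fun r : ℝ => 2 * (r * ‖h‖) := by fun_prop
        exact (this.tendsto' 0 0 (by simp)).mono_left nhdsWithin_le_nhds
      · filter_upwards [self_mem_nhdsWithin] with r (hr : 0 < r)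
        simp only [Set.mem_Ici]; positivity
    have hc : Filter.Tendsto φ (nhdsWithin 0 (Set.Ici 0)) (nhds (φ 0)) :=
      hφ.continuousOn 0 (by simp)
    have he : Continuous fun x : ℝ => Complex.exp (x * Complex.I) * h := by fun_prop
    refine ((he.tendsto _).comp (hc.comp hm)).congr' ?_
    filter_upwards [self_mem_nhdsWithin] with r (hr : 0 < r)
    have : (r : ℂ) ≠ 0 := by exact_mod_cast hr.ne'
    simp [slope, hT, abs_of_pos hr]
    field_simp
  have hfd (w : ℂ) (hw : w ≠ 0) : ∃ l : ℝ, ∀ h, fderiv ℝ T w h =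
      Complex.exp (φ (2 * ‖w‖) * Complex.I) * (h + (l * inner ℝ w h : ℝ) * (Complex.I * w)) := by
    have hw' : 0 < ‖w‖ := norm_pos_iff.2 hw
    have hφ' : HasDerivAt φ (deriv φ (2 * ‖w‖)) (2 * √(‖w‖ ^ 2)) := by
      rw [Real.sqrt_sq hw'.le]
      exact ((hφ.contDiffAt (Ici_mem_nhds (by positivity))).differentiableAt
        (by simp)).hasDerivAt
    have hχ := hφ'.comp (‖w‖ ^ 2)
      ((Real.hasDerivAt_sqrt (by positivity : ‖w‖ ^ 2 ≠ 0)).const_mul 2)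
    have hn := (hasStrictFDerivAt_norm_sq w).hasFDerivAt
    have hρ := HasDerivAt.comp_hasFDerivAt (f := fun x : ℂ => ‖x‖ ^ 2) w hχ hn
    have hρ' : HasFDerivAt (fun w : ℂ => φ (2 * ‖w‖)) _ w :=
      hρ.congr_of_eventuallyEq (Filter.Eventually.of_forall fun x => by
        simp [Real.sqrt_sq (norm_nonneg x)])
    have he := ((Complex.ofRealCLM.hasFDerivAt.comp w hρ').mul_const Complex.I).cexp.mul
      (hasFDerivAt_id w)
    have he' : HasFDerivAt T _ w := he
    rw [he'.fderiv]
    refine ⟨deriv φ (2 * ‖w‖) * (2 * (1 / (2 * √(‖w‖ ^ 2)))) * 2, fun h => ?_⟩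
    simp
    ring
  refine ⟨hsm, by simp [hT], by simp [hT], fun w h k => ?_,
    Complex.exp (φ 0 * Complex.I), by simpa [Complex.exp_ofReal_mul_I_im] using hs, h0⟩
  by_cases hw : w = 0
  · rw [hw, h0, h0, wedge_mul_left, Complex.normSq_eq_norm_sq, Complex.norm_exp_ofReal_mul_I]
    simp
  · obtain ⟨l, hl⟩ := hfd w hw
    rw [hl, hl, wedge_mul_left, Complex.normSq_eq_norm_sq, Complex.norm_exp_ofReal_mul_I]
    simp [wedge, Complex.inner]
    ring

/-- Parametrization of the twisted torus near `γ × {0}`. -/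
def chordMap (c : ℝ → ℂ) (T : ℂ → ℂ) (x : ℝ × ℝ) : ℂ × ℂ :=
  ((midDiffCLM (c (x.1 + x.2), c (x.1 - x.2))).1, T (midDiffCLM (c (x.1 + x.2), c (x.1 - x.2))).2)

lemma chordMap_reflect {c : ℝ → ℂ} {T : ℂ → ℂ} (hT : IsFibreTwist T) (θ σ : ℝ) :
    chordMap c T (θ, -σ) = ((chordMap c T (θ, σ)).1, -(chordMap c T (θ, σ)).2) := by
  simp only [chordMap, midDiffCLM_apply, midDiff, sub_neg_eq_add, ← sub_eq_add_neg, ← hT.odd,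
    Prod.mk.injEq]
  constructor
  · ring
  · congr 1; ring

lemma chordMap_zero {c : ℝ → ℂ} {T : ℂ → ℂ} (hT : IsFibreTwist T) (θ : ℝ) :
    chordMap c T (θ, 0) = (c θ, 0) := by
  simp [chordMap, midDiff, hT.map_zero]

namespace IsRegularLoop

variable {c : ℝ → ℂ}

lemma chordMap_add_period (hc : IsRegularLoop c) (T : ℂ → ℂ) (θ σ : ℝ) :
    chordMap c T (θ + 2 * Real.pi, σ) = chordMap c T (θ, σ) := by
  simp only [chordMap, add_right_comm θ, add_sub_right_comm θ, hc.periodic _]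

lemma hasFDerivAt_chord (hc : IsRegularLoop c) (x : ℝ × ℝ) :
    HasFDerivAt (fun x : ℝ × ℝ => midDiffCLM (c (x.1 + x.2), c (x.1 - x.2)))
      (midDiffCLM.comp (((ContinuousLinearMap.toSpanSingleton ℝ (deriv c (x.1 + x.2))).comp
        (ContinuousLinearMap.fst ℝ ℝ ℝ + ContinuousLinearMap.snd ℝ ℝ ℝ)).prod
        ((ContinuousLinearMap.toSpanSingleton ℝ (deriv c (x.1 - x.2))).comp
        (ContinuousLinearMap.fst ℝ ℝ ℝ - ContinuousLinearMap.snd ℝ ℝ ℝ)))) x := by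
  have hd (t : ℝ) := ((hc.contDiff.differentiable (by simp)) t).hasDerivAt.hasFDerivAt
  have h1 := HasFDerivAt.comp (f := fun x : ℝ × ℝ => x.1 + x.2) x (hd _)
    (hasFDerivAt_fst.add hasFDerivAt_snd)
  have h2 := HasFDerivAt.comp (f := fun x : ℝ × ℝ => x.1 - x.2) x (hd _)
    (hasFDerivAt_fst.sub hasFDerivAt_snd)
  exact midDiffCLM.hasFDerivAt.comp x (h1.prodMk h2)

lemma contDiff_chordMap (hc : IsRegularLoop c) {T : ℂ → ℂ} (hT : IsFibreTwist T) :
    ContDiff ℝ ∞ (chordMap c T) := by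
  have h : ContDiff ℝ ∞ fun x : ℝ × ℝ => midDiffCLM (c (x.1 + x.2), c (x.1 - x.2)) :=
    midDiffCLM.contDiff.comp ((hc.contDiff.comp (contDiff_fst.add contDiff_snd)).prodMk
      (hc.contDiff.comp (contDiff_fst.sub contDiff_snd)))
  exact (contDiff_fst.comp h).prodMk (hT.contDiff.comp (contDiff_snd.comp h))

lemma fderiv_chordMap (hc : IsRegularLoop c) {T : ℂ → ℂ} (hT : IsFibreTwist T) (x v : ℝ × ℝ) :
    fderiv ℝ (chordMap c T) x v =
      ((midDiff ((v.1 + v.2) • deriv c (x.1 + x.2), (v.1 - v.2) • deriv c (x.1 - x.2))).1,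
        fderiv ℝ T (midDiff (c (x.1 + x.2), c (x.1 - x.2))).2
        (midDiff ((v.1 + v.2) • deriv c (x.1 + x.2), (v.1 - v.2) • deriv c (x.1 - x.2))).2) := by
  have h := hc.hasFDerivAt_chord x
  have h2 := HasFDerivAt.comp x ((hT.contDiff.differentiable (by simp) _).hasFDerivAt) h.snd
  have h3 : HasFDerivAt (chordMap c T) _ x := h.fst.prodMk h2
  rw [h3.fderiv]
  simp [add_mul, sub_mul]

/-- The twisted torus is Lagrangian. -/
lemma stdForm_fderiv_chordMap (hc : IsRegularLoop c) {T : ℂ → ℂ} (hT : IsFibreTwist T) (x v w :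
    ℝ × ℝ) :
    stdForm (fderiv ℝ (chordMap c T) x v) (fderiv ℝ (chordMap c T) x w) = 0 := by
  rw [hc.fderiv_chordMap hT, hc.fderiv_chordMap hT, stdForm_eq, hT.area]
  refine (stdForm_midDiff _ _).trans ?_
  simp [wedge]
  ring

lemma fderiv_chordMap_zero (hc : IsRegularLoop c) {T : ℂ → ℂ} (hT : IsFibreTwist T) (θ : ℝ) (v :
    ℝ × ℝ) :
    fderiv ℝ (chordMap c T) (θ, 0) v = (v.1 • deriv c θ, fderiv ℝ T 0 (v.2 • deriv c θ)) := by
  rw [hc.fderiv_chordMap hT]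
  simp only [midDiff, add_zero, sub_zero, sub_self, zero_div, Prod.mk.injEq, ← sub_smul,
    ← add_smul]
  constructor
  · simp; ring
  · congr 1; simp; ring

end IsRegularLoop

/-! ### Inverse and implicit functions -/

section Inverse

variable {E F : Type*} [NormedAddCommGroup E] [NormedSpace ℝ E] [FiniteDimensional ℝ E]
  [NormedAddCommGroup F] [NormedSpace ℝ F] [FiniteDimensional ℝ F]

/-- The inverse function theorem, with an inverse that is smooth on the whole target. -/
theorem exists_smooth_local_inverse (hEF : Module.finrank ℝ E = Module.finrank ℝ F) {f : E → F}
    {Ω : Set E} (hΩ : IsOpen Ω) (hf : ∀ x ∈ Ω, ContDiffAt ℝ ∞ f x) {a : E} (ha : a ∈ Ω)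
    (hinj : ∀ v, fderiv ℝ f a v = 0 → v = 0) :
    ∃ e : OpenPartialHomeomorph E F, a ∈ e.source ∧ e.source ⊆ Ω ∧ (e : E → F) = f ∧
      ∀ q ∈ e.target, ContDiffAt ℝ ∞ e.symm q := by
  have : CompleteSpace E := FiniteDimensional.complete ℝ E
  have : CompleteSpace F := FiniteDimensional.complete ℝ F
  have hinj' : Function.Injective (fderiv ℝ f a) := (injective_iff_map_eq_zero _).2 hinj
  let f' : E ≃L[ℝ] F :=
    ((fderiv ℝ f a : E →ₗ[ℝ] F).linearEquivOfInjective hinj' hEF).toContinuousLinearEquiv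
  have hf' : (f' : E →L[ℝ] F) = fderiv ℝ f a := by ext v; rfl
  have hd : HasFDerivAt f (f' : E →L[ℝ] F) a :=
    hf' ▸ ((hf a ha).differentiableAt (by simp)).hasFDerivAt
  have hcont : ContinuousOn (fderiv ℝ f) Ω := fun x hx =>
    (((hf x hx).fderiv_right (m := 0) (by simp)).continuousAt).continuousWithinAt
  -- Invertibility of the derivative is an open condition; restricting to it makes the inverse
  -- smooth at every point of the target.
  let Ω' := Ω ∩ fderiv ℝ f ⁻¹' Set.range ((↑) : (E ≃L[ℝ] F) → E →L[ℝ] F)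
  have hΩ' : IsOpen Ω' := hcont.isOpen_inter_preimage hΩ ContinuousLinearEquiv.isOpen
  let e := ((hf a ha).toOpenPartialHomeomorph f hd (by simp)).restrOpen Ω' hΩ'
  refine ⟨e, ⟨(hf a ha).mem_toOpenPartialHomeomorph_source hd (by simp), ha, f', hf'⟩,
    fun x hx => hx.2.1, rfl, fun q hq => ?_⟩
  have hs : e.symm q ∈ e.source := e.map_target hq
  obtain ⟨hx, g, hg⟩ := hs.2
  refine e.contDiffAt_symm (f₀' := g) hq ?_ (hf _ hx)
  rw [hg]
  exact ((hf _ hx).differentiableAt (by simp)).hasFDerivAt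

end Inverse

/-- A local bound that is invariant under translation by a period can be chosen uniformly. -/
lemma exists_uniform_of_periodic {T : ℝ} (hT : 0 < T) {P : ℝ → ℝ → Prop}
    (hper : ∀ θ r, P θ r → ∀ k : ℤ, P (θ + k * T) r)
    (hmono : ∀ θ r r', P θ r → r' ≤ r → P θ r')
    (hloc : ∀ θ₀, ∃ r > 0, ∀ᶠ θ in nhds θ₀, P θ r) : ∃ r > 0, ∀ θ, P θ r := by
  have key : ∃ r > 0, ∀ θ ∈ Set.Icc 0 T, P θ r := by
    refine isCompact_Icc.induction_on (p := fun s => ∃ r > 0, ∀ θ ∈ s, P θ r)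
      ⟨1, one_pos, by simp⟩ (fun s t hst ⟨r, hr, h⟩ => ⟨r, hr, fun θ hθ => h θ (hst hθ)⟩) ?_ ?_
    · rintro s t ⟨r, hr, h⟩ ⟨r', hr', h'⟩
      refine ⟨min r r', lt_min hr hr', fun θ hθ => ?_⟩
      rcases hθ with hθ | hθ
      · exact hmono _ _ _ (h θ hθ) (min_le_left _ _)
      · exact hmono _ _ _ (h' θ hθ) (min_le_right _ _)
    · intro θ₀ _
      obtain ⟨r, hr, h⟩ := hloc θ₀
      exact ⟨_, mem_nhdsWithin_of_mem_nhds h, r, hr, fun θ hθ => hθ⟩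
  obtain ⟨r, hr, h⟩ := key
  refine ⟨r, hr, fun θ => ?_⟩
  have h1 := hper _ r (h (toIcoMod hT 0 θ)
    (Set.Ico_subset_Icc_self (by simpa using toIcoMod_mem_Ico hT 0 θ))) (toIcoDiv hT 0 θ)
  have h2 := toIcoMod_add_toIcoDiv_zsmul hT 0 θ
  rw [zsmul_eq_mul] at h2
  rwa [h2] at h1

section Implicit

variable {Y Z : Type*} [NormedAddCommGroup Y] [NormedSpace ℝ Y] [FiniteDimensional ℝ Y]
  [NormedAddCommGroup Z] [NormedSpace ℝ Z] [FiniteDimensional ℝ Z]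

/-- An implicit function along a line of solutions of a periodic equation, defined on a uniform
neighbourhood of the line. -/
theorem exists_periodic_implicit (hYZ : Module.finrank ℝ Y = Module.finrank ℝ Z) {T : ℝ}
    (hT : 0 < T) {g : (ℝ × ℝ) × Y → Z} {Ω : Set ((ℝ × ℝ) × Y)} (hΩ : IsOpen Ω)
    (hg : ∀ p ∈ Ω, ContDiffAt ℝ ∞ g p)
    (hgper : ∀ τ y, Function.Periodic (fun θ => g ((θ, τ), y)) T)
    (hΩper : ∀ τ y, Function.Periodic (fun θ => ((θ, τ), y) ∈ Ω) T)
    (hmem : ∀ θ, ((θ, 0), 0) ∈ Ω) (hzero : ∀ θ, g ((θ, 0), 0) = 0)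
    (hinj : ∀ θ y, fderiv ℝ g ((θ, 0), 0) (0, y) = 0 → y = 0) :
    ∃ δ > 0, ∃ η > 0, ∃ f : ℝ × ℝ → Y, ∀ x : ℝ × ℝ, |x.2| < η →
      ContDiffAt ℝ ∞ f x ∧ f x ∈ Metric.ball 0 δ ∧ (x, f x) ∈ Ω ∧ g (x, f x) = 0 ∧
        ∀ y ∈ Metric.ball 0 δ, g (x, y) = 0 → y = f x := by
  -- The inverse function theorem is applied to `(x, y) ↦ (x, g (x, y))`.
  have hloc (θ : ℝ) : ∃ e : OpenPartialHomeomorph ((ℝ × ℝ) × Y) ((ℝ × ℝ) × Z),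
      ((θ, 0), 0) ∈ e.source ∧ e.source ⊆ Ω ∧ (e : (ℝ × ℝ) × Y → (ℝ × ℝ) × Z) =
        (fun p => (p.1, g p)) ∧ ∀ q ∈ e.target, ContDiffAt ℝ ∞ e.symm q := by
    refine exists_smooth_local_inverse (by simp [hYZ]) hΩ
      (fun p hp => contDiff_fst.contDiffAt.prodMk (hg p hp)) (hmem θ) fun v hv => ?_
    have hd := hasFDerivAt_fst.prodMk
      ((hg _ (hmem θ)).differentiableAt (by simp)).hasFDerivAt
    rw [hd.fderiv] at hv
    obtain ⟨h1, h2⟩ := Prod.mk.inj hv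
    obtain ⟨v1, v2⟩ := v
    obtain rfl : v1 = 0 := h1
    rw [hinj θ v2 h2]
    rfl
  have hshift (x : ℝ × ℝ) (k : ℤ) (y : Y) : g ((x.1 + k * T, x.2), y) = g (x, y) :=
    (hgper x.2 y).int_mul k x.1
  have hball {θ₀ r θ : ℝ} (hθ : θ ∈ Metric.ball θ₀ (r / 2)) :
      Metric.ball ((θ, 0) : ℝ × ℝ) (r / 2) ⊆ Metric.ball (θ₀, 0) r := by
    refine Metric.ball_subset_ball' ?_
    have : dist ((θ, 0) : ℝ × ℝ) (θ₀, 0) = dist θ θ₀ := by simp [Prod.dist_eq]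
    rw [this]
    linarith [Metric.mem_ball.1 hθ]
  have hsh {θ r : ℝ} {k : ℤ} {x : ℝ × ℝ} (hx : x ∈ Metric.ball (θ + k * T, 0) r) :
      (x.1 + (-k : ℤ) * T, x.2) ∈ Metric.ball (θ, (0 : ℝ)) r := by
    rw [Metric.mem_ball, Prod.dist_eq] at hx ⊢
    simp only [Real.dist_eq] at hx ⊢
    convert hx using 3
    push_cast
    ring
  -- The uniqueness radius `δ` is fixed before the width `η`: local solutions for different `θ` are
  -- compared inside one common ball. Here `r` may still depend on `θ`.
  obtain ⟨δ, hδ, huniq⟩ : ∃ δ > 0, ∀ θ : ℝ, ∃ r > 0, ∀ x ∈ Metric.ball ((θ, 0) : ℝ × ℝ) r,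
      ∀ y ∈ Metric.ball (0 : Y) δ, ∀ y' ∈ Metric.ball (0 : Y) δ,
        g (x, y) = 0 → g (x, y') = 0 → y = y' := by
    refine exists_uniform_of_periodic hT ?_ ?_ ?_
    · rintro θ δ ⟨r, hr, h⟩ k
      refine ⟨r, hr, fun x hx y hy y' hy' h1 h2 => h _ (hsh hx) y hy y' hy' ?_ ?_⟩
      · rwa [hshift]
      · rwa [hshift]
    · rintro θ δ δ' ⟨r, hr, h⟩ hle
      exact ⟨r, hr, fun x hx y hy y' hy' =>
        h x hx y (Metric.ball_subset_ball hle hy) y' (Metric.ball_subset_ball hle hy')⟩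
    · intro θ₀
      obtain ⟨e, he, -, hef, -⟩ := hloc θ₀
      obtain ⟨r, hr, hre⟩ := Metric.isOpen_iff.1 e.open_source _ he
      refine ⟨r, hr, ?_⟩
      filter_upwards [Metric.ball_mem_nhds θ₀ (half_pos hr)] with θ hθ
      refine ⟨r / 2, half_pos hr, fun x hx y hy y' hy' h1 h2 => ?_⟩
      have hmem' (y : Y) (hy : y ∈ Metric.ball (0 : Y) r) : (x, y) ∈ e.source := by
        refine hre ?_
        rw [← ball_prod_same]
        exact ⟨hball hθ hx, hy⟩
      have := e.injOn (hmem' y hy) (hmem' y' hy') (by rw [hef]; simp [h1, h2])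
      exact (Prod.mk.inj this).2
  obtain ⟨η, hη, hsol⟩ : ∃ η > 0, ∀ θ : ℝ, ∃ f : ℝ × ℝ → Y,
      ∀ x ∈ Metric.ball ((θ, 0) : ℝ × ℝ) η, ContDiffAt ℝ ∞ f x ∧ f x ∈ Metric.ball 0 δ ∧
        (x, f x) ∈ Ω ∧ g (x, f x) = 0 ∧ ∀ y ∈ Metric.ball 0 δ, g (x, y) = 0 → y = f x := by
    refine exists_uniform_of_periodic hT ?_ ?_ ?_
    · rintro θ η ⟨f, hf⟩ k
      refine ⟨fun x => f (x.1 + (-k : ℤ) * T, x.2), fun x hx => ?_⟩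
      obtain ⟨h1, h2, h3, h4, h5⟩ := hf _ (hsh hx)
      refine ⟨?_, h2, ?_, ?_, fun y hy h => h5 y hy ?_⟩
      · exact h1.comp x ((contDiff_fst.add contDiff_const).prodMk contDiff_snd).contDiffAt
      · exact ((hΩper x.2 _).int_mul (-k) x.1).mp h3
      · rwa [hshift] at h4
      · rwa [hshift]
    · rintro θ η η' ⟨f, hf⟩ hle
      exact ⟨f, fun x hx => hf x (Metric.ball_subset_ball hle hx)⟩
    · intro θ₀
      obtain ⟨e, he, heΩ, hef, hes⟩ := hloc θ₀
      obtain ⟨r, hr, hre⟩ := huniq θ₀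
      have he0 : e ((θ₀, 0), 0) = ((θ₀, 0), 0) := by rw [hef]; simp [hzero]
      let f : ℝ × ℝ → Y := fun x => (e.symm (x, 0)).2
      have hf0 : f (θ₀, 0) = 0 := by
        simp only [f]
        rw [← he0, e.left_inv he]
      have ht : ∀ᶠ x : ℝ × ℝ in nhds (θ₀, 0), (x, (0 : Z)) ∈ e.target := by
        have hc : Continuous fun x : ℝ × ℝ => (x, (0 : Z)) := by fun_prop
        refine hc.continuousAt.eventually_mem (e.open_target.mem_nhds ?_)
        rw [← he0]
        exact e.map_source he
      have hfsm (x : ℝ × ℝ) (hx : (x, (0 : Z)) ∈ e.target) : ContDiffAt ℝ ∞ f x :=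
        contDiff_snd.contDiffAt.comp x ((hes _ hx).comp x
          (contDiff_id.prodMk contDiff_const).contDiffAt)
      have hfδ : ∀ᶠ x in nhds ((θ₀, 0) : ℝ × ℝ), f x ∈ Metric.ball 0 δ :=
        (hfsm _ ht.self_of_nhds).continuousAt.eventually_mem
          (by rw [hf0]; exact Metric.ball_mem_nhds 0 hδ)
      obtain ⟨η, hη, hηs⟩ := Metric.eventually_nhds_iff_ball.1
        ((ht.and hfδ).and (Metric.ball_mem_nhds _ hr))
      refine ⟨η / 2, half_pos hη, ?_⟩
      filter_upwards [Metric.ball_mem_nhds θ₀ (half_pos hη)] with θ hθ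
      refine ⟨f, fun x hx => ?_⟩
      obtain ⟨⟨h1, h2⟩, h3⟩ := hηs x (hball hθ hx)
      have h4 : e (e.symm (x, 0)) = (x, 0) := e.right_inv h1
      rw [hef] at h4
      obtain ⟨h5, h6⟩ := Prod.mk.inj h4
      have h7 : e.symm (x, 0) = (x, f x) := Prod.ext h5 rfl
      rw [h7] at h6
      exact ⟨hfsm x h1, h2, heΩ (h7 ▸ e.map_target h1), h6,
        fun y hy h => hre x h3 y hy _ h2 h h6⟩
  choose F hF using hsol
  have hself (x : ℝ × ℝ) (hx : |x.2| < η) : x ∈ Metric.ball ((x.1, 0) : ℝ × ℝ) η := by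
    rw [Metric.mem_ball, Prod.dist_eq]
    simpa [Real.dist_eq, hη] using hx
  -- The diagonal choice is smooth because near `x` uniqueness in the `δ`-ball identifies it with
  -- the single function `F x.1`.
  refine ⟨δ, hδ, η, hη, fun x => F x.1 x, fun x hx => ?_⟩
  obtain ⟨h1, h2⟩ := hF x.1 x (hself x hx)
  refine ⟨h1.congr_of_eventuallyEq ?_, h2⟩
  have hη' : ∀ᶠ z : ℝ × ℝ in nhds x, |z.2| < η :=
    (continuous_abs.comp continuous_snd).continuousAt.eventually_lt_const hx
  filter_upwards [Metric.isOpen_ball.mem_nhds (hself x hx), hη'] with z hz hz'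
  obtain ⟨-, k2, -, k4, -⟩ := hF z.1 z (hself z hz')
  exact (hF x.1 z hz).2.2.2.2 _ k2 k4

end Implicit

/-! ### Straightening the twisted torus by a shear -/

/-- The equation expressing that the point of the twisted torus with parameters `(θ + h, σ)` has
the coordinates `(θ, s, t₁, τ)`, where `y = (h, σ, s, t₁)`. -/
def graphEq (c : ℝ → ℂ) (T : ℂ → ℂ) (p : (ℝ × ℝ) × (ℝ × ℝ × ℝ × ℝ)) : ℂ × ℂ :=
  tubeMap c (p.1.1, p.2.2.2.1, p.2.2.2.2, p.1.2) - chordMap c T (p.1.1 + p.2.1, p.2.2.1)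

/-- In the coordinates `tubeMap`, the twisted torus is a graph over the plane of `(θ, t₂)`:
`f = (h, σ, s, t₁)` solves `graphEq` uniquely near zero. -/
structure IsTwistedGraph (c : ℝ → ℂ) (T : ℂ → ℂ) (δ η : ℝ) (f : ℝ × ℝ → ℝ × ℝ × ℝ × ℝ) :
    Prop where
  pos : 0 < δ
  pos' : 0 < η
  contDiffAt : ∀ x : ℝ × ℝ, |x.2| < η → ContDiffAt ℝ ∞ f x
  mem_ball : ∀ x : ℝ × ℝ, |x.2| < η → f x ∈ Metric.ball 0 δ
  mem_tubeDomain : ∀ x : ℝ × ℝ, |x.2| < η →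
    (x.1, (f x).2.2.1, (f x).2.2.2, x.2) ∈ tubeDomain c
  graphEq_eq_zero : ∀ x : ℝ × ℝ, |x.2| < η → graphEq c T (x, f x) = 0
  unique : ∀ x : ℝ × ℝ, |x.2| < η → ∀ y ∈ Metric.ball 0 δ, graphEq c T (x, y) = 0 → y = f x
  eq_zero : ∀ x : ℝ × ℝ, ¬ |x.2| < η → f x = 0

/-- This is where transversality enters. The linearised equation at the core reads `i t₁ / a = h`
and `s = e σ`; as all unknowns are real and `e.im ≠ 0`, they vanish. The shift `h` allows the
parameter of the twisted torus to differ from the coordinate `θ`. -/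
theorem exists_isTwistedGraph {c : ℝ → ℂ} {T : ℂ → ℂ} (hc : IsRegularLoop c)
    (hT : IsFibreTwist T) : ∃ δ η f, IsTwistedGraph c T δ η f := by
  let π₁ : (ℝ × ℝ) × (ℝ × ℝ × ℝ × ℝ) →L[ℝ] ℝ × ℝ × ℝ × ℝ := LinearMap.toContinuousLinearMap
    { toFun := fun p => (p.1.1, p.2.2.2.1, p.2.2.2.2, p.1.2)
      map_add' := fun _ _ => rfl
      map_smul' := fun _ _ => rfl }
  let π₂ : (ℝ × ℝ) × (ℝ × ℝ × ℝ × ℝ) →L[ℝ] ℝ × ℝ := LinearMap.toContinuousLinearMap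
    { toFun := fun p => (p.1.1 + p.2.1, p.2.2.1)
      map_add' := fun p q => by ext <;> simp; ring
      map_smul' := fun r p => by ext <;> simp; ring }
  have hsm : ∀ p ∈ π₁ ⁻¹' tubeDomain c, ContDiffAt ℝ ∞ (graphEq c T) p := fun p hp =>
    ((hc.contDiffAt_tubeMap hp).comp p π₁.contDiff.contDiffAt).sub
      ((hc.contDiff_chordMap hT).comp π₂.contDiff).contDiffAt
  obtain ⟨δ, hδ, η, hη, f, hf⟩ := exists_periodic_implicit (g := graphEq c T)
    (Ω := π₁ ⁻¹' tubeDomain c) (T := 2 * Real.pi) (by simp) Real.two_pi_pos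
    (hc.isOpen_tubeDomain.preimage π₁.continuous) hsm
    (fun τ y θ => by
      simp only [graphEq, hc.tubeMap_add_period, add_right_comm θ, hc.chordMap_add_period])
    (fun τ y θ => propext (hc.mem_tubeDomain_add_period θ _))
    (fun θ => hc.mem_tubeDomain_zero θ 0)
    (fun θ => by simp [graphEq, chordMap_zero hT, midDiff]) fun θ y hy => by
      have h1 : HasFDerivAt (tubeMap c) _ (π₁ ((θ, 0), 0)) :=
        ((hc.contDiffAt_tubeMap (hc.mem_tubeDomain_zero θ 0)).differentiableAt
          (by simp)).hasFDerivAt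
      have h2 : HasFDerivAt (chordMap c T) (fderiv ℝ (chordMap c T) (θ, 0)) (π₂ ((θ, 0), 0)) := by
        have : π₂ ((θ, 0), 0) = (θ, 0) := by simp [π₂]
        rw [this]
        exact ((hc.contDiff_chordMap hT).differentiable (by simp) _).hasFDerivAt
      have h3 : HasFDerivAt (graphEq c T) _ ((θ, 0), 0) :=
        (h1.comp _ π₁.hasFDerivAt).sub (h2.comp _ π₂.hasFDerivAt)
      have h4 : fderiv ℝ (tubeMap c) (θ, 0, 0, 0) (0, y.2.2.1, y.2.2.2, 0) -
          fderiv ℝ (chordMap c T) (θ, 0) (0 + y.1, y.2.1) = 0 := by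
        rw [h3.fderiv] at hy
        exact hy
      obtain ⟨e, he, hTe⟩ := hT.fderiv_zero
      rw [hc.fderiv_tubeMap_zero, hc.fderiv_chordMap_zero hT, hTe] at h4
      have ha := hc.normSq_pos θ
      have hd := hc.deriv_ne_zero θ
      obtain ⟨k1, k2⟩ := Prod.mk.inj h4
      have k1' : deriv c θ * (((y.2.2.2 / Complex.normSq (deriv c θ) : ℝ) : ℂ) * Complex.I -
          (y.1 : ℂ)) = 0 := by
        simp at k1
        push_cast
        linear_combination k1
      have k2' : deriv c θ * ((y.2.2.1 : ℂ) - e * (y.2.1 : ℂ)) = 0 := by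
        simp at k2
        linear_combination k2
      have m1 := (mul_eq_zero.1 k1').resolve_left hd
      have m2 := (mul_eq_zero.1 k2').resolve_left hd
      have n1 : y.2.2.2 = 0 := by
        have := congrArg Complex.im m1
        simpa [ha.ne', div_eq_zero_iff, hd] using this
      have n2 : y.1 = 0 := by
        have := congrArg Complex.re m1
        simpa [n1] using this
      have n3 : y.2.1 = 0 := by
        have := congrArg Complex.im m2
        simpa [he] using this
      have n4 : y.2.2.1 = 0 := by
        have := congrArg Complex.re m2
        simpa [n3] using this
      exact Prod.ext n2 (Prod.ext n3 (Prod.ext n4 n1))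
  classical
  -- Extension by zero beyond the strip makes periodicity and reflection symmetry hold for every
  -- `t₂`.
  let F : ℝ × ℝ → ℝ × ℝ × ℝ × ℝ := fun x => if |x.2| < η then f x else 0
  have hF (x : ℝ × ℝ) (hx : |x.2| < η) : F x = f x := if_pos hx
  refine ⟨δ, η, F, hδ, hη, fun x hx => ?_, fun x hx => hF x hx ▸ (hf x hx).2.1,
    fun x hx => hF x hx ▸ (hf x hx).2.2.1, fun x hx => hF x hx ▸ (hf x hx).2.2.2.1,
    fun x hx => hF x hx ▸ (hf x hx).2.2.2.2, fun x hx => if_neg hx⟩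
  refine (hf x hx).1.congr_of_eventuallyEq ?_
  filter_upwards [(continuous_abs.comp continuous_snd).continuousAt.eventually_lt_const hx]
    with z hz using hF z hz

/-- The shear in the coordinates `(s, t₁)` by the corresponding components of `f (θ, t₂)`. -/
def shear (f : ℝ × ℝ → ℝ × ℝ × ℝ × ℝ) (p : ℝ × ℝ × ℝ × ℝ) : ℝ × ℝ × ℝ × ℝ :=
  (p.1, p.2.1 + (f (p.1, p.2.2.2)).2.2.1, p.2.2.1 + (f (p.1, p.2.2.2)).2.2.2, p.2.2.2)

/-! ### Symmetries of the graph and symplecticity of the shear -/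

namespace IsTwistedGraph

variable {c : ℝ → ℂ} {T : ℂ → ℂ} {δ η : ℝ} {f : ℝ × ℝ → ℝ × ℝ × ℝ × ℝ}

lemma add_period (hf : IsTwistedGraph c T δ η f) (hc : IsRegularLoop c) (θ τ : ℝ) :
    f (θ + 2 * Real.pi, τ) = f (θ, τ) := by
  by_cases hτ : |τ| < η
  · refine hf.unique (θ, τ) hτ _ (hf.mem_ball (θ + 2 * Real.pi, τ) hτ) ?_
    have := hf.graphEq_eq_zero (θ + 2 * Real.pi, τ) hτ
    simpa only [graphEq, hc.tubeMap_add_period, add_right_comm θ (2 * Real.pi),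
    hc.chordMap_add_period]
      using this
  · rw [hf.eq_zero _ hτ, hf.eq_zero _ hτ]

lemma apply_zero (hf : IsTwistedGraph c T δ η f) (hT : IsFibreTwist T) (θ : ℝ) : f (θ, 0) = 0 := by
  have h0 : |((θ, 0) : ℝ × ℝ).2| < η := by simpa using hf.pos'
  refine (hf.unique _ h0 0 (Metric.mem_ball_self hf.pos) ?_).symm
  simp [graphEq, chordMap_zero hT, midDiff]

/-- Reflection preserves the equation and the sup-norm ball, so uniqueness applies. The parity of
the `s` and `t₁` parts makes the shear commute with the involution. -/
lemma apply_neg (hf : IsTwistedGraph c T δ η f) (hT : IsFibreTwist T) (θ τ : ℝ) :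
    f (θ, -τ) = ((f (θ, τ)).1, -(f (θ, τ)).2.1, -(f (θ, τ)).2.2.1, (f (θ, τ)).2.2.2) := by
  by_cases hτ : |τ| < η
  · have hτ' : |((θ, -τ) : ℝ × ℝ).2| < η := by simpa using hτ
    refine (hf.unique _ hτ' _ ?_ ?_).symm
    · have := hf.mem_ball (θ, τ) hτ
      simpa [Prod.norm_def] using this
    · have := hf.graphEq_eq_zero (θ, τ) hτ
      simp only [graphEq, tubeMap_reflect, chordMap_reflect hT] at this ⊢
      obtain ⟨h1, h2⟩ := Prod.ext_iff.1 this
      refine Prod.ext h1 ?_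
      simp only [Prod.snd_sub, Prod.snd_zero] at h2 ⊢
      linear_combination -h2
  · have hτ' : ¬ |((θ, -τ) : ℝ × ℝ).2| < η := by simpa using hτ
    rw [hf.eq_zero _ hτ', hf.eq_zero (θ, τ) hτ]
    simp [Prod.ext_iff]

/-- The graph is Lagrangian. -/
lemma fderiv_add_fderiv (hf : IsTwistedGraph c T δ η f) (hc : IsRegularLoop c) (hT :
    IsFibreTwist T) {x : ℝ × ℝ}
    (hx : |x.2| < η) :
    (fderiv ℝ f x (1, 0)).2.2.1 + (fderiv ℝ f x (0, 1)).2.2.2 = 0 := by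
  have hd := ((hf.contDiffAt x hx).differentiableAt (by simp)).hasFDerivAt
  have h1 := (hasFDerivAt_fst (𝕜 := ℝ) (p := x)).prodMk
    (hd.snd.snd.fst.prodMk (hd.snd.snd.snd.prodMk (hasFDerivAt_snd (𝕜 := ℝ) (p := x))))
  have h2 := HasFDerivAt.comp x ((hc.contDiffAt_tubeMap (hf.mem_tubeDomain x hx)).differentiableAt
    (by simp)).hasFDerivAt h1
  have h3 := ((hasFDerivAt_fst (𝕜 := ℝ) (p := x)).add hd.fst).prodMk hd.snd.fst
  have h4 := HasFDerivAt.comp x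
    ((hc.contDiff_chordMap hT).differentiable (by simp) _).hasFDerivAt h3
  have heq := h2.unique (h4.congr_of_eventuallyEq ?_)
  -- The form is evaluated on the two coordinate tangent vectors of the graph: `flatForm` yields the
  -- sum in question, the twisted torus yields zero.
  · have hs := hc.stdForm_fderiv_tubeMap (hf.mem_tubeDomain x hx)
      (1, (fderiv ℝ f x (1, 0)).2.2.1, (fderiv ℝ f x (1, 0)).2.2.2, 0)
      (0, (fderiv ℝ f x (0, 1)).2.2.1, (fderiv ℝ f x (0, 1)).2.2.2, 1)
    have e1 := congrArg (fun L => L (1, 0)) heq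
    have e2 := congrArg (fun L => L (0, 1)) heq
    have e1' : fderiv ℝ (tubeMap c) (x.1, (f x).2.2.1, (f x).2.2.2, x.2)
      (1, (fderiv ℝ f x (1, 0)).2.2.1, (fderiv ℝ f x (1, 0)).2.2.2, 0) = _ := e1
    have e2' : fderiv ℝ (tubeMap c) (x.1, (f x).2.2.1, (f x).2.2.2, x.2)
      (0, (fderiv ℝ f x (0, 1)).2.2.1, (fderiv ℝ f x (0, 1)).2.2.2, 1) = _ := e2
    rw [e1', e2'] at hs
    have hz := hs.symm.trans (hc.stdForm_fderiv_chordMap hT _ _ _)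
    simp only [flatForm] at hz
    linarith
  · filter_upwards [(continuous_abs.comp continuous_snd).continuousAt.eventually_lt_const hx]
      with z hz
    exact sub_eq_zero.1 (hf.graphEq_eq_zero z hz)

/-- The shear alters the form by `(S_θ + A_{t₂}) dθ ∧ dt₂`, which `fderiv_add_fderiv` kills. -/
lemma shear_properties (hf : IsTwistedGraph c T δ η f) (hc : IsRegularLoop c) (hT :
    IsFibreTwist T) {p : ℝ × ℝ × ℝ × ℝ}
    (hp : |p.2.2.2| < η) : ContDiffAt ℝ ∞ (shear f) p ∧
      ∀ v w, flatForm (fderiv ℝ (shear f) p v) (fderiv ℝ (shear f) p w) = flatForm v w := by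
  let π : ℝ × ℝ × ℝ × ℝ →L[ℝ] ℝ × ℝ := LinearMap.toContinuousLinearMap
    { toFun := fun p => (p.1, p.2.2.2)
      map_add' := fun _ _ => rfl
      map_smul' := fun _ _ => rfl }
  have hs := (hf.contDiffAt (π p) hp).comp p π.contDiff.contDiffAt
  have hfst : ContDiffAt ℝ ∞ (fun p : ℝ × ℝ × ℝ × ℝ => p.1) p := contDiff_fst.contDiffAt
  have hsnd : ContDiffAt ℝ ∞ (fun p : ℝ × ℝ × ℝ × ℝ => p.2) p := contDiff_snd.contDiffAt
  refine ⟨hfst.prodMk ((hsnd.fst.add hs.snd.snd.fst).prodMk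
    ((hsnd.snd.fst.add hs.snd.snd.snd).prodMk hsnd.snd.snd)), fun v w => ?_⟩
  have hd := ((hf.contDiffAt (π p) hp).differentiableAt (by simp)).hasFDerivAt.comp p π.hasFDerivAt
  have hfst' := hasFDerivAt_fst (𝕜 := ℝ) (p := p)
  have hsnd' := hasFDerivAt_snd (𝕜 := ℝ) (p := p)
  have h : HasFDerivAt (shear f) _ p := hfst'.prodMk ((hsnd'.fst.add hd.snd.snd.fst).prodMk
    ((hsnd'.snd.fst.add hd.snd.snd.snd).prodMk hsnd'.snd.snd))
  have hlin (u : ℝ × ℝ) : fderiv ℝ f (π p) u =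
      u.1 • fderiv ℝ f (π p) (1, 0) + u.2 • fderiv ℝ f (π p) (0, 1) := by
    conv_lhs => rw [show u = u.1 • (1, 0) + u.2 • (0, 1) by ext <;> simp]
    rw [map_add, map_smul, map_smul]
  have hv (v : ℝ × ℝ × ℝ × ℝ) : fderiv ℝ (shear f) p v =
      (v.1, v.2.1 + (v.1 * (fderiv ℝ f (π p) (1, 0)).2.2.1 +
          v.2.2.2 * (fderiv ℝ f (π p) (0, 1)).2.2.1),
        v.2.2.1 + (v.1 * (fderiv ℝ f (π p) (1, 0)).2.2.2 +
          v.2.2.2 * (fderiv ℝ f (π p) (0, 1)).2.2.2), v.2.2.2) := by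
    rw [h.fderiv]
    change (v.1, v.2.1 + (fderiv ℝ f (π p) (v.1, v.2.2.2)).2.2.1,
      v.2.2.1 + (fderiv ℝ f (π p) (v.1, v.2.2.2)).2.2.2, v.2.2.2) = _
    rw [hlin (v.1, v.2.2.2)]
    rfl
  rw [hv, hv]
  simp only [flatForm]
  linear_combination (v.1 * w.2.2.2 - w.1 * v.2.2.2) *
    hf.fderiv_add_fderiv hc hT (x := π p) hp

end IsTwistedGraph

/-- A lift to `ℝ⁴` of a symplectic map that straightens both the torus and the twisted torus. -/
structure IsAdaptedLift (c : ℝ → ℂ) (T : ℂ → ℂ) (V : Set (ℝ × ℝ × ℝ × ℝ))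
    (F : ℝ × ℝ × ℝ × ℝ → ℂ × ℂ) : Prop where
  isOpen : IsOpen V
  core_mem : ∀ θ, (θ, 0, 0, 0) ∈ V
  mem_add_period : ∀ θ x, (θ + 2 * Real.pi, x) ∈ V ↔ (θ, x) ∈ V
  contDiffAt : ∀ p ∈ V, ContDiffAt ℝ ∞ F p
  symplectic : ∀ p ∈ V, ∀ v w, stdForm (fderiv ℝ F p v) (fderiv ℝ F p w) = flatForm v w
  add_period : ∀ θ x, F (θ + 2 * Real.pi, x) = F (θ, x)
  reflect : ∀ θ s t₁ t₂, F (θ, -s, t₁, -t₂) = ((F (θ, s, t₁, t₂)).1, -(F (θ, s, t₁, t₂)).2)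
  torus : ∀ θ s, F (θ, s, 0, 0) = midDiff (c (θ + s), c (θ - s))
  twisted : ∀ θ τ, (θ, 0, 0, τ) ∈ V → ∃ x, F (θ, 0, 0, τ) = chordMap c T x
  unique : ∀ θ₀ : ℝ, ∀ᶠ q : (ℝ × ℝ × ℝ × ℝ) × (ℝ × ℝ) in nhds ((θ₀, 0, 0, 0), (θ₀, 0)),
    F q.1 = chordMap c T q.2 → q.1.2.1 = 0 ∧ q.1.2.2.1 = 0

theorem exists_isAdaptedLift {c : ℝ → ℂ} {T : ℂ → ℂ} (hc : IsRegularLoop c)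
    (hT : IsFibreTwist T) : ∃ V F, IsAdaptedLift c T V F := by
  obtain ⟨δ, η, f, hf⟩ := exists_isTwistedGraph hc hT
  let V₀ : Set (ℝ × ℝ × ℝ × ℝ) := {p | |p.2.2.2| < η}
  have hV₀ : IsOpen V₀ := isOpen_lt (by fun_prop) continuous_const
  have hcs : ContinuousOn (shear f) V₀ := fun p hp =>
    (hf.shear_properties hc hT hp).1.continuousAt.continuousWithinAt
  have hcore (θ s : ℝ) : shear f (θ, s, 0, 0) = (θ, s, 0, 0) := by
    simp [shear, hf.apply_zero hT]
  have hper (θ : ℝ) (x : ℝ × ℝ × ℝ) : shear f (θ + 2 * Real.pi, x) =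
      ((shear f (θ, x)).1 + 2 * Real.pi, (shear f (θ, x)).2) := by
    simp [shear, hf.add_period hc]
  refine ⟨V₀ ∩ shear f ⁻¹' tubeDomain c, tubeMap c ∘ shear f,
    hcs.isOpen_inter_preimage hV₀ hc.isOpen_tubeDomain, fun θ => ?_, fun θ x => ?_,
    fun p hp => ?_, fun p hp v w => ?_, fun θ x => ?_, fun θ s t₁ t₂ => ?_, fun θ s => ?_,
    fun θ τ h => ?_, fun θ₀ => ?_⟩
  · refine ⟨by simpa [V₀] using hf.pos', ?_⟩
    rw [Set.mem_preimage, hcore]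
    exact hc.mem_tubeDomain_zero θ 0
  · refine and_congr Iff.rfl ?_
    rw [Set.mem_preimage, hper, hc.mem_tubeDomain_add_period]
    rfl
  · exact (hc.contDiffAt_tubeMap hp.2).comp p (hf.shear_properties hc hT hp.1).1
  · obtain ⟨h1, h2⟩ := hf.shear_properties hc hT hp.1
    rw [fderiv_comp p ((hc.contDiffAt_tubeMap hp.2).differentiableAt (by simp))
      (h1.differentiableAt (by simp)), ContinuousLinearMap.comp_apply,
      ContinuousLinearMap.comp_apply, hc.stdForm_fderiv_tubeMap hp.2, h2]
  · rw [Function.comp_apply, hper, hc.tubeMap_add_period]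
    rfl
  · simp only [Function.comp_apply, shear, hf.apply_neg hT, ← neg_add]
    exact tubeMap_reflect _ _ _ _ _
  · rw [Function.comp_apply, hcore, tubeMap_zero]
  · refine ⟨(θ + (f (θ, τ)).1, (f (θ, τ)).2.1), ?_⟩
    have := sub_eq_zero.1 (hf.graphEq_eq_zero (θ, τ) h.1)
    simpa [shear] using this
  -- Near the core, the parameter shift, `σ` and the sheared `(s, t₁)` form a small solution of
  -- `graphEq`. Uniqueness makes the sheared pair the value of `f`, so the pair before shearing is
  -- zero.
  · have hcont : ContinuousAt (fun q : (ℝ × ℝ × ℝ × ℝ) × (ℝ × ℝ) =>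
        ((q.2.1 - q.1.1, q.2.2, (shear f q.1).2.1, (shear f q.1).2.2.1) : ℝ × ℝ × ℝ × ℝ))
        ((θ₀, 0, 0, 0), (θ₀, 0)) := by
      have h0 : ContinuousAt (shear f) (((θ₀, 0, 0, 0), (θ₀, 0)) :
          (ℝ × ℝ × ℝ × ℝ) × (ℝ × ℝ)).1 :=
        (hf.shear_properties hc hT (by simpa using hf.pos')).1.continuousAt
      have h1 := h0.comp (f := Prod.fst) (x := ((θ₀, 0, 0, 0), (θ₀, 0))) continuousAt_fst
      have h2 : ContinuousAt (fun q : (ℝ × ℝ × ℝ × ℝ) × (ℝ × ℝ) => q.2.1 - q.1.1)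
        ((θ₀, 0, 0, 0), (θ₀, 0)) := by fun_prop
      have h3 : ContinuousAt (fun q : (ℝ × ℝ × ℝ × ℝ) × (ℝ × ℝ) => q.2.2)
        ((θ₀, 0, 0, 0), (θ₀, 0)) := by fun_prop
      exact h2.prodMk (h3.prodMk (h1.snd.fst.prodMk h1.snd.snd.fst))
    have hb := hcont.eventually_mem (s := Metric.ball 0 δ) (by
      simp only [hcore]
      refine Metric.isOpen_ball.mem_nhds ?_
      simp [hf.pos])
    have hη : ∀ᶠ q : (ℝ × ℝ × ℝ × ℝ) × (ℝ × ℝ) in nhds ((θ₀, 0, 0, 0), (θ₀, 0)),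
        |q.1.2.2.2| < η := by
      have : Continuous fun q : (ℝ × ℝ × ℝ × ℝ) × (ℝ × ℝ) => |q.1.2.2.2| := by fun_prop
      exact this.continuousAt.eventually_lt_const (by simpa using hf.pos')
    filter_upwards [hb, hη] with q hq hqη heq
    have h := hf.unique (q.1.1, q.1.2.2.2) hqη _ hq (by
      simp only [graphEq, add_sub_cancel]
      exact sub_eq_zero.2 heq)
    have h' := (Prod.ext_iff.1 (Prod.ext_iff.1 h).2).2
    obtain ⟨h3, h4⟩ := Prod.ext_iff.1 h'
    simp only [shear] at h3 h4
    exact ⟨by linarith, by linarith⟩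

/-! ### Descent to the circle -/

/-- The universal covering `(θ, s, t₁, t₂) ↦ (e^{iθ}, s, t₁, t₂)`. -/
def cover (p : ℝ × ℝ × ℝ × ℝ) : Ambient := (Circle.exp p.1, p.2)

/-- The local section of `cover` with values near `θ₀`. -/
def coverSection (θ₀ : ℝ) (q : Ambient) : ℝ × ℝ × ℝ × ℝ :=
  (θ₀ + Complex.arg (Complex.exp (-(θ₀ * Complex.I)) * q.1), q.2)

lemma contMDiff_cover : ContMDiff 𝓘(ℝ, ℝ × ℝ × ℝ × ℝ) ambientModel ∞ cover :=
  (contMDiff_circleExp.comp contDiff_fst.contMDiff).prodMk contDiff_snd.contMDiff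

lemma contMDiff_coe_fst :
    ContMDiff ambientModel 𝓘(ℝ, ℂ) ∞ (fun q : Ambient => (q.1 : ℂ)) :=
  have : Fact (Module.finrank ℝ ℂ = 1 + 1) := finrank_real_complex_fact'
  (contMDiff_coe_sphere (E := ℂ) (n := 1)).comp contMDiff_fst

lemma contMDiff_snd_ambient :
    ContMDiff ambientModel 𝓘(ℝ, ℝ × ℝ × ℝ) ∞ (fun q : Ambient => q.2) :=
  contMDiff_snd

lemma cover_coverSection (θ₀ : ℝ) (q : Ambient) : cover (coverSection θ₀ q) = q := by
  refine Prod.ext ?_ rfl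
  have h : (Complex.exp (-(θ₀ * Complex.I)) * q.1 : ℂ) =
      ((Circle.exp (-θ₀) * q.1 : Circle) : ℂ) := by
    simp [Circle.coe_exp, Complex.exp_neg]
  simp only [cover, coverSection]
  rw [h, Circle.exp_add, Circle.exp_arg, ← mul_assoc, ← Circle.exp_add]
  simp

lemma exp_mul_exp_cover (θ₀ : ℝ) (x : ℝ × ℝ × ℝ) :
    (Complex.exp (-(θ₀ * Complex.I)) * (cover (θ₀, x)).1 : ℂ) = 1 := by
  simp [cover, Circle.coe_exp, ← Complex.exp_add]

lemma coverSection_cover (θ₀ : ℝ) (x : ℝ × ℝ × ℝ) :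
    coverSection θ₀ (cover (θ₀, x)) = (θ₀, x) := by
  rw [coverSection, exp_mul_exp_cover]
  simp [cover]

/-- Rotation by `-θ₀` moves the base point to `1`, off the branch cut, where `arg` is the imaginary
part of a smooth logarithm. -/
lemma contMDiffAt_coverSection (θ₀ : ℝ) (x : ℝ × ℝ × ℝ) :
    ContMDiffAt ambientModel 𝓘(ℝ, ℝ × ℝ × ℝ × ℝ) ∞ (coverSection θ₀) (cover (θ₀, x)) := by
  have hlog : ContDiffAt ℝ ∞ (fun z : ℂ => Complex.log (Complex.exp (-(θ₀ * Complex.I)) * z))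
      ((cover (θ₀, x)).1 : ℂ) := by
    refine ContDiffAt.comp (g := Complex.log) _ ?_ (contDiff_const.mul contDiff_id).contDiffAt
    refine ContDiffAt.restrict_scalars ℝ (Complex.contDiffAt_log ?_)
    rw [exp_mul_exp_cover]
    exact Complex.one_mem_slitPlane
  have harg : ContDiffAt ℝ ∞ (fun z : ℂ => θ₀ + (Complex.log
      (Complex.exp (-(θ₀ * Complex.I)) * z)).im) ((cover (θ₀, x)).1 : ℂ) :=
    contDiffAt_const.add (ContDiffAt.comp (g := Complex.im) _
      Complex.imCLM.contDiff.contDiffAt hlog)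
  have heq : coverSection θ₀ = fun q : Ambient =>
      (θ₀ + (Complex.log (Complex.exp (-(θ₀ * Complex.I)) * q.1)).im, q.2) := by
    ext1 q
    rw [Complex.log_im]
    rfl
  rw [heq]
  exact (harg.contMDiffAt.comp (cover (θ₀, x)) contMDiff_coe_fst.contMDiffAt).prodMk_space
    contMDiff_snd_ambient.contMDiffAt

lemma map_nhds_cover (p : ℝ × ℝ × ℝ × ℝ) : Filter.map cover (nhds p) = nhds (cover p) := by
  have h : cover = Prod.map Circle.exp id := rfl
  rw [h, nhds_prod_eq, ← Filter.prod_map_map_eq', isLocalHomeomorph_circleExp.map_nhds_eq,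
    Filter.map_id, ← nhds_prod_eq]
  rfl

/-- This makes the differential of the covering surjective, so identities of forms may be checked on
lifted vectors. -/
lemma mfderiv_cover_mfderiv_coverSection (θ₀ : ℝ) (x : ℝ × ℝ × ℝ)
    (v : TangentSpace ambientModel (cover (θ₀, x))) :
    mfderiv 𝓘(ℝ, ℝ × ℝ × ℝ × ℝ) ambientModel cover (θ₀, x)
      (mfderiv ambientModel 𝓘(ℝ, ℝ × ℝ × ℝ × ℝ) (coverSection θ₀) (cover (θ₀, x)) v) = v := by
  have h1 : MDifferentiableAt 𝓘(ℝ, ℝ × ℝ × ℝ × ℝ) ambientModel cover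
      (coverSection θ₀ (cover (θ₀, x))) := contMDiff_cover.mdifferentiableAt (by simp)
  have h2 := (contMDiffAt_coverSection θ₀ x).mdifferentiableAt (by simp)
  have h3 := mfderiv_comp_apply (cover (θ₀, x)) h1 h2 v
  have h4 : cover ∘ coverSection θ₀ = id := funext (cover_coverSection θ₀)
  rw [h4, mfderiv_id, coverSection_cover] at h3
  exact h3.symm

lemma mfderiv_mfderiv_cover {E' : Type*} [NormedAddCommGroup E'] [NormedSpace ℝ E']
    {f : Ambient → E'} {g : ℝ × ℝ × ℝ × ℝ → E'} {p : ℝ × ℝ × ℝ × ℝ}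
    (hf : MDifferentiableAt ambientModel 𝓘(ℝ, E') f (cover p)) (hg : f ∘ cover = g)
    (v : ℝ × ℝ × ℝ × ℝ) :
    mfderiv ambientModel 𝓘(ℝ, E') f (cover p)
      (mfderiv 𝓘(ℝ, ℝ × ℝ × ℝ × ℝ) ambientModel cover p v) = fderiv ℝ g p v := by
  have h := mfderiv_comp_apply p hf (contMDiff_cover.mdifferentiableAt (by simp)) v
  rw [← h, hg, mfderiv_eq_fderiv]
  rfl

lemma modelForm_mfderiv_cover (p v w : ℝ × ℝ × ℝ × ℝ) :
    modelForm (cover p) (mfderiv 𝓘(ℝ, ℝ × ℝ × ℝ × ℝ) ambientModel cover p v)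
      (mfderiv 𝓘(ℝ, ℝ × ℝ × ℝ × ℝ) ambientModel cover p w) = flatForm v w := by
  have hs : ContMDiff ambientModel 𝓘(ℝ, ℝ) ∞ coordS :=
    (contDiff_fst (𝕜 := ℝ) (E := ℝ) (F := ℝ × ℝ)).contMDiff.comp contMDiff_snd_ambient
  have ht₁ : ContMDiff ambientModel 𝓘(ℝ, ℝ) ∞ coordT₁ :=
    ((contDiff_fst (𝕜 := ℝ) (E := ℝ) (F := ℝ)).comp contDiff_snd).contMDiff.comp
      contMDiff_snd_ambient
  have ht₂ : ContMDiff ambientModel 𝓘(ℝ, ℝ) ∞ coordT₂ :=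
    ((contDiff_snd (𝕜 := ℝ) (E := ℝ) (F := ℝ)).comp contDiff_snd).contMDiff.comp
      contMDiff_snd_ambient
  have h2 := hasFDerivAt_snd (𝕜 := ℝ) (p := p)
  have es (v : ℝ × ℝ × ℝ × ℝ) : differential coordS (cover p)
      (mfderiv 𝓘(ℝ, ℝ × ℝ × ℝ × ℝ) ambientModel cover p v) = v.2.1 := by
    refine (mfderiv_mfderiv_cover (hs.mdifferentiableAt (by simp))
      (g := fun p => p.2.1) rfl v).trans ?_
    rw [h2.fst.fderiv]
    rfl
  have et₁ (v : ℝ × ℝ × ℝ × ℝ) : differential coordT₁ (cover p)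
      (mfderiv 𝓘(ℝ, ℝ × ℝ × ℝ × ℝ) ambientModel cover p v) = v.2.2.1 := by
    refine (mfderiv_mfderiv_cover (ht₁.mdifferentiableAt (by simp))
      (g := fun p => p.2.2.1) rfl v).trans ?_
    rw [h2.snd.fst.fderiv]
    rfl
  have et₂ (v : ℝ × ℝ × ℝ × ℝ) : differential coordT₂ (cover p)
      (mfderiv 𝓘(ℝ, ℝ × ℝ × ℝ × ℝ) ambientModel cover p v) = v.2.2.2 := by
    refine (mfderiv_mfderiv_cover (ht₂.mdifferentiableAt (by simp))
      (g := fun p => p.2.2.2) rfl v).trans ?_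
    rw [h2.snd.snd.fderiv]
    rfl
  have eθ (v : ℝ × ℝ × ℝ × ℝ) : dTheta (cover p)
      (mfderiv 𝓘(ℝ, ℝ × ℝ × ℝ × ℝ) ambientModel cover p v) = v.1 := by
    have hz : dZeta (cover p) (mfderiv 𝓘(ℝ, ℝ × ℝ × ℝ × ℝ) ambientModel cover p v) =
        Complex.exp (p.1 * Complex.I) * (v.1 * Complex.I) := by
      have h1 := hasFDerivAt_fst (𝕜 := ℝ) (p := p)
      have h3 : HasFDerivAt (fun p : ℝ × ℝ × ℝ × ℝ => Complex.exp (p.1 * Complex.I)) _ p :=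
        ((Complex.ofRealCLM.hasFDerivAt.comp p h1).mul_const Complex.I).cexp
      have h4 : fderiv ℝ (fun p : ℝ × ℝ × ℝ × ℝ => Complex.exp (p.1 * Complex.I)) p v =
          Complex.exp (p.1 * Complex.I) * (v.1 * Complex.I) := by
        rw [h3.fderiv]
        simp
        ring
      refine (mfderiv_mfderiv_cover (contMDiff_coe_fst.mdifferentiableAt (by simp))
        (g := fun p => Complex.exp (p.1 * Complex.I)) ?_ v).trans h4
      ext p
      simp [cover, Circle.coe_exp]
    have hn : (starRingEnd ℂ) ((cover p).1 : ℂ) * Complex.exp (p.1 * Complex.I) = 1 := by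
      have : ((cover p).1 : ℂ) = Complex.exp (p.1 * Complex.I) := by simp [cover, Circle.coe_exp]
      rw [this, ← Complex.normSq_eq_conj_mul_self, Complex.normSq_eq_norm_sq,
        Complex.norm_exp_ofReal_mul_I]
      simp
    rw [dTheta, hz, ← mul_assoc, hn]
    simp
  rw [modelForm, es, es, et₁, et₁, et₂, et₂, eθ, eθ, flatForm]

/-! ### The descended map and its local inverses -/

namespace IsAdaptedLift

variable {c : ℝ → ℂ} {T : ℂ → ℂ} {V : Set (ℝ × ℝ × ℝ × ℝ)} {F : ℝ × ℝ × ℝ × ℝ → ℂ × ℂ}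

/-- The map on `S¹ × ℝ × ℝ × ℝ` covered by a periodic map on `ℝ⁴`. -/
def descent (F : ℝ × ℝ × ℝ × ℝ → ℂ × ℂ) (q : Ambient) : ℂ × ℂ := F (Complex.arg q.1, q.2)

lemma descent_cover (hF : IsAdaptedLift c T V F) (p : ℝ × ℝ × ℝ × ℝ) :
    descent F (cover p) = F p := by
  obtain ⟨m, hm⟩ := Circle.exp_eq_exp.1 (Circle.exp_arg (Circle.exp p.1))
  have hper : Function.Periodic (fun θ => F (θ, p.2)) (2 * Real.pi) :=
    fun θ => hF.add_period θ p.2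
  rw [descent, cover, hm]
  exact hper.int_mul m p.1

lemma descent_comp_cover (hF : IsAdaptedLift c T V F) :
    descent F ∘ cover = F := funext hF.descent_cover

/-- Although `arg` jumps, periodicity allows any section in its place, in particular one smooth near
the point considered. -/
lemma descent_eq (hF : IsAdaptedLift c T V F) (θ₀ : ℝ) : descent F = F ∘ coverSection θ₀ := by
  ext1 q
  rw [Function.comp_apply, ← hF.descent_cover, cover_coverSection]

lemma contMDiffAt_descent (hF : IsAdaptedLift c T V F) {p : ℝ × ℝ × ℝ × ℝ} (hp : p ∈ V) :
    ContMDiffAt ambientModel 𝓘(ℝ, ℂ × ℂ) ∞ (descent F) (cover p) := by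
  rw [hF.descent_eq p.1]
  refine ContMDiffAt.comp _ ?_ (contMDiffAt_coverSection p.1 p.2)
  rw [coverSection_cover]
  exact (hF.contDiffAt p hp).contMDiffAt

/-- A vector killed by the derivative pairs to zero with everything under the nondegenerate
`flatForm`. -/
lemma exists_local_inverse (hF : IsAdaptedLift c T V F) {p : ℝ × ℝ × ℝ × ℝ} (hp : p ∈ V) :
    ∃ e : OpenPartialHomeomorph (ℝ × ℝ × ℝ × ℝ) (ℂ × ℂ), p ∈ e.source ∧ e.source ⊆ V ∧
      (e : ℝ × ℝ × ℝ × ℝ → ℂ × ℂ) = F ∧ ∀ q ∈ e.target, ContDiffAt ℝ ∞ e.symm q := by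
  refine exists_smooth_local_inverse (by simp) hF.isOpen hF.contDiffAt hp fun v hv => ?_
  have h (w : ℝ × ℝ × ℝ × ℝ) : flatForm v w = 0 := by
    rw [← hF.symplectic p hp, hv]
    simp [stdForm]
  have h1 := h (0, 0, 1, 0)
  have h2 := h (0, 0, 0, 1)
  have h3 := h (1, 0, 0, 0)
  have h4 := h (0, 1, 0, 0)
  simp [flatForm] at h1 h2 h3 h4
  exact Prod.ext h1 (Prod.ext h2 (Prod.ext h3 h4))

lemma map_nhds_descent (hF : IsAdaptedLift c T V F) {p : ℝ × ℝ × ℝ × ℝ} (hp : p ∈ V) :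
    Filter.map (descent F) (nhds (cover p)) = nhds (F p) := by
  obtain ⟨e, he, -, hef, -⟩ := hF.exists_local_inverse hp
  rw [← map_nhds_cover, Filter.map_map, hF.descent_comp_cover, ← hef]
  exact e.map_nhds_eq he

/-- An injective restriction of the descended map is a symplectomorphism onto its image. -/
theorem exists_symplectomorphism (hF : IsAdaptedLift c T V F) {U : Set Ambient} (hU :
    IsOpen U) (hUV : U ⊆ cover '' V)
    (hinj : Set.InjOn (descent F) U) : ∃ Ψ : OpenPartialHomeomorph Ambient (ℂ × ℂ),
      IsSymplectomorphism Ψ ∧ Ψ.source = U ∧ (Ψ : Ambient → ℂ × ℂ) = descent F := by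
  have hsm : ContMDiffOn ambientModel 𝓘(ℝ, ℂ × ℂ) ∞ (descent F) U := by
    intro q hq
    obtain ⟨p, hp, rfl⟩ := hUV hq
    exact (hF.contMDiffAt_descent hp).contMDiffWithinAt
  have hopen : IsOpenMap (U.domRestrict (descent F)) := by
    intro s hs
    have hs' : IsOpen ((↑) '' s : Set Ambient) := hU.isOpenMap_subtype_val s hs
    have himg : U.domRestrict (descent F) '' s = descent F '' ((↑) '' s) := by
      rw [Set.image_image]
      rfl
    rw [himg, isOpen_iff_mem_nhds]
    rintro _ ⟨q, hq, rfl⟩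
    have hqU : q ∈ U := by
      obtain ⟨x, -, rfl⟩ := hq
      exact x.2
    obtain ⟨p, hp, rfl⟩ := hUV hqU
    rw [hF.descent_cover, ← hF.map_nhds_descent hp]
    exact Filter.image_mem_map (hs'.mem_nhds hq)
  let Ψ : OpenPartialHomeomorph Ambient (ℂ × ℂ) :=
    OpenPartialHomeomorph.ofContinuousOpenRestrict (hinj.toPartialEquiv (descent F) U)
      hsm.continuousOn hopen hU
  have hsrc : Ψ.source = U := rfl
  have hcoe : (Ψ : Ambient → ℂ × ℂ) = descent F := rfl
  refine ⟨Ψ, ⟨hsm, fun y hy => ?_, fun q hq v w => ?_⟩, hsrc, hcoe⟩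
  · have hx : Ψ.symm y ∈ Ψ.source := Ψ.map_target hy
    obtain ⟨p, hp, hpx⟩ := hUV hx
    have hFp : F p = y := by
      rw [← hF.descent_cover, hpx, ← hcoe, Ψ.right_inv hy]
    obtain ⟨e, he, -, hef, hes⟩ := hF.exists_local_inverse hp
    have hyt : y ∈ e.target := by
      rw [← hFp, ← hef]
      exact e.map_source he
    have hey : e.symm y = p := by
      rw [← hFp, ← hef]
      exact e.left_inv he
    -- Near `y` the inverse coincides with the smooth map `cover ∘ e.symm`.
    have hs : ContMDiffAt 𝓘(ℝ, ℂ × ℂ) ambientModel ∞ (cover ∘ e.symm) y :=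
      contMDiff_cover.contMDiffAt.comp y (hes y hyt).contMDiffAt
    refine (hs.congr_of_eventuallyEq ?_).contMDiffWithinAt
    have hmem : (cover ∘ e.symm) y ∈ Ψ.source := by
      rw [Function.comp_apply, hey, hpx]
      exact hx
    filter_upwards [hs.continuousAt.eventually_mem (Ψ.open_source.mem_nhds hmem),
      e.open_target.mem_nhds hyt] with z hz hzt
    have : Ψ (cover (e.symm z)) = z := by
      rw [hcoe, hF.descent_cover, ← hef, e.right_inv hzt]
    have hl : Ψ.symm (Ψ (cover (e.symm z))) = cover (e.symm z) := Ψ.left_inv hz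
    rwa [this] at hl
  · obtain ⟨p, hp, rfl⟩ := hUV hq
    have hd : MDifferentiableAt ambientModel 𝓘(ℝ, ℂ × ℂ) (descent F) (cover p) :=
      (hF.contMDiffAt_descent hp).mdifferentiableAt (by simp)
    obtain ⟨v', hv⟩ : ∃ v', mfderiv 𝓘(ℝ, ℝ × ℝ × ℝ × ℝ) ambientModel cover p v' = v :=
      ⟨_, mfderiv_cover_mfderiv_coverSection p.1 p.2 v⟩
    obtain ⟨w', hw⟩ : ∃ w', mfderiv 𝓘(ℝ, ℝ × ℝ × ℝ × ℝ) ambientModel cover p w' = w :=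
      ⟨_, mfderiv_cover_mfderiv_coverSection p.1 p.2 w⟩
    subst hv hw
    refine Eq.trans ?_ ((hF.symplectic p hp v' w').trans (modelForm_mfderiv_cover p v' w').symm)
    exact congrArg₂ stdForm (mfderiv_mfderiv_cover hd hF.descent_comp_cover v')
      (mfderiv_mfderiv_cover hd hF.descent_comp_cover w')

end IsAdaptedLift

/-! ### Neighbourhoods of the core -/

lemma IsRegularLoop.exists_int_of_eq {c : ℝ → ℂ} (hc : IsRegularLoop c) {α β : ℝ}
    (h : c α = c β) : ∃ k : ℤ, α = β + k * (2 * Real.pi) := by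
  have hval (x : ℝ) : c (toIcoMod Real.two_pi_pos 0 x) = c x := by
    rw [toIcoMod, zsmul_eq_mul, hc.periodic.sub_int_mul_eq]
  have hmem (x : ℝ) : toIcoMod Real.two_pi_pos 0 x ∈ Set.Ico 0 (2 * Real.pi) := by
    simpa using toIcoMod_mem_Ico Real.two_pi_pos 0 x
  have heq := hc.injOn (hmem α) (hmem β) (by rw [hval, hval, h])
  refine ⟨toIcoDiv Real.two_pi_pos 0 α - toIcoDiv Real.two_pi_pos 0 β, ?_⟩
  have h1 := toIcoMod_add_toIcoDiv_zsmul Real.two_pi_pos 0 α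
  have h2 := toIcoMod_add_toIcoDiv_zsmul Real.two_pi_pos 0 β
  rw [zsmul_eq_mul] at h1 h2
  push_cast
  linear_combination heq - h1 + h2

/-- Near a set `K`, the image of a doubly periodic map `f` comes only from parameters close to
those of `K`. -/
lemma exists_isOpen_forall_mem {P : ℝ} (hP : 0 < P) {X : Type*} [TopologicalSpace X] [T2Space X]
    {f : ℝ × ℝ → X} (hf : Continuous f)
    (hper : ∀ (x : ℝ × ℝ) (k m : ℤ), f (x.1 + k * P, x.2 + m * P) = f x) {O : Set (ℝ × ℝ)}
    {K : Set X} (hO : ∀ x, f x ∈ K → ∃ k m : ℤ, O ∈ nhds (x.1 + k * P, x.2 + m * P)) :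
    ∃ N, IsOpen N ∧ K ⊆ N ∧ ∀ x, f x ∈ N → ∃ x' ∈ O, f x' = f x := by
  let O' : Set (ℝ × ℝ) := ⋃ (k : ℤ) (m : ℤ),
    (fun x : ℝ × ℝ => (x.1 + k * P, x.2 + m * P)) ⁻¹' interior O
  have hO' : IsOpen O' := isOpen_iUnion fun k => isOpen_iUnion fun m =>
    isOpen_interior.preimage (by fun_prop)
  -- These are the parameters in a fundamental square with no translate in the interior of `O`.
  -- Their image is compact and misses `K`; its complement is the required `N`.
  have hcomp : IsCompact ((Set.Icc 0 P ×ˢ Set.Icc 0 P) \ O') :=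
    (isCompact_Icc.prod isCompact_Icc).diff hO'
  refine ⟨(f '' ((Set.Icc 0 P ×ˢ Set.Icc 0 P) \ O'))ᶜ, (hcomp.image hf).isClosed.isOpen_compl,
    ?_, fun x hx => ?_⟩
  · rintro _ hq ⟨x, hx, rfl⟩
    obtain ⟨k, m, hkm⟩ := hO x hq
    exact hx.2 (Set.mem_iUnion₂.2 ⟨k, m, mem_interior_iff_mem_nhds.2 hkm⟩)
  · let y : ℝ × ℝ := (toIcoMod hP 0 x.1, toIcoMod hP 0 x.2)
    have hmem (t : ℝ) : toIcoMod hP 0 t ∈ Set.Icc 0 P :=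
      Set.Ico_subset_Icc_self (by simpa using toIcoMod_mem_Ico hP 0 t)
    have hy : f y = f x := by
      have h := hper x (-toIcoDiv hP 0 x.1) (-toIcoDiv hP 0 x.2)
      rw [← h]
      simp only [y, toIcoMod, zsmul_eq_mul, Int.cast_neg, neg_mul, sub_eq_add_neg]
    have hyO : y ∈ O' := by
      by_contra hn
      exact hx ⟨y, ⟨⟨hmem _, hmem _⟩, hn⟩, hy⟩
    obtain ⟨k, m, hkm⟩ := Set.mem_iUnion₂.1 hyO
    exact ⟨_, interior_subset hkm, (hper y k m).trans hy⟩

/-- The torus twisted by `T`, parametrized by pairs of points of the curve. -/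
def pairMap (c : ℝ → ℂ) (T : ℂ → ℂ) (x : ℝ × ℝ) : ℂ × ℂ :=
  ((midDiff (c x.1, c x.2)).1, T (midDiff (c x.1, c x.2)).2)

lemma pairMap_eq_chordMap (c : ℝ → ℂ) (T : ℂ → ℂ) (x : ℝ × ℝ) :
    pairMap c T x = chordMap c T ((x.1 + x.2) / 2, (x.1 - x.2) / 2) := by
  simp only [pairMap, chordMap, midDiffCLM_apply]
  rw [show (x.1 + x.2) / 2 + (x.1 - x.2) / 2 = x.1 by ring,
    show (x.1 + x.2) / 2 - (x.1 - x.2) / 2 = x.2 by ring]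

lemma chordMap_eq_pairMap (c : ℝ → ℂ) (T : ℂ → ℂ) (x : ℝ × ℝ) :
    chordMap c T x = pairMap c T (x.1 + x.2, x.1 - x.2) := by
  simp [pairMap, chordMap]

lemma image_torus_eq_range (c : ℝ → ℂ) (T : ℂ → ℂ) :
    (fun p : ℂ × ℂ => (p.1, T p.2)) '' torus (Set.range c) = Set.range (pairMap c T) := by
  rw [torus, Set.image_image, ← Set.range_prodMap, ← Set.range_comp]
  rfl

/-- As `T` vanishes only at `0`, a point over the core comes from two equal points of the curve,
that is, from a translate of the diagonal by full periods. In the coordinates of `chordMap` half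
periods would appear. -/
lemma IsRegularLoop.exists_isOpen_pairMap {c : ℝ → ℂ} (hc : IsRegularLoop c) {T : ℂ → ℂ}
    (hT : Continuous T) (hT₀ : ∀ w, T w = 0 → w = 0) {O : Set (ℝ × ℝ)}
    (hO : ∀ α, O ∈ nhds (α, α)) :
    ∃ N, IsOpen N ∧ Set.range c ×ˢ {0} ⊆ N ∧
      ∀ x, pairMap c T x ∈ N → ∃ x' ∈ O, pairMap c T x' = pairMap c T x := by
  have hcont : Continuous (pairMap c T) := by
    have := hc.contDiff.continuous
    unfold pairMap midDiff
    fun_prop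
  refine exists_isOpen_forall_mem Real.two_pi_pos hcont (fun x k m => ?_) fun x hx => ?_
  · simp only [pairMap, (hc.periodic.int_mul k) _, (hc.periodic.int_mul m) _]
  · have h : (midDiff (c x.1, c x.2)).2 = 0 := hT₀ _ hx.2
    have heq : c x.1 = c x.2 := by
      simp only [midDiff] at h
      linear_combination 2 * h
    obtain ⟨k, hk⟩ := hc.exists_int_of_eq heq
    refine ⟨0, k, ?_⟩
    rw [← hk]
    simpa using hO x.1

lemma isCompact_coreCircle : IsCompact coreCircle := by
  have : coreCircle = Set.univ ×ˢ {0} := by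
    ext q
    simp [coreCircle, Prod.ext_iff]
  rw [this]
  exact isCompact_univ.prod isCompact_singleton

lemma continuous_involution : Continuous involution := by
  unfold involution
  fun_prop

lemma involution_involution (q : Ambient) : involution (involution q) = q := by
  simp [involution]

lemma rotation_pi (q : ℂ × ℂ) : rotation Real.pi q = (q.1, -q.2) := by
  simp [rotation, Complex.exp_pi_mul_I]

lemma mem_coreCircle_iff {q : Ambient} : q ∈ coreCircle ↔ ∃ θ, q = cover (θ, 0, 0, 0) := by
  constructor
  · rintro ⟨h1, h2, h3⟩
    exact ⟨Complex.arg q.1, Prod.ext (Circle.exp_arg q.1).symm (Prod.ext h1 (Prod.ext h2 h3))⟩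
  · rintro ⟨θ, rfl⟩
    exact ⟨rfl, rfl, rfl⟩

/-! ### Choice of the neighbourhoods and images of `L₀` and `L₁` -/

namespace IsAdaptedLift

variable {c : ℝ → ℂ} {T : ℂ → ℂ} {V : Set (ℝ × ℝ × ℝ × ℝ)} {F : ℝ × ℝ × ℝ × ℝ → ℂ × ℂ}

lemma apply_core (hF : IsAdaptedLift c T V F) (θ : ℝ) : F (θ, 0, 0, 0) = (c θ, 0) := by
  rw [hF.torus]
  simp [midDiff]

lemma descent_involution (hF : IsAdaptedLift c T V F) (q : Ambient) :
    descent F (involution q) = rotation Real.pi (descent F q) := by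
  rw [rotation_pi]
  exact hF.reflect _ _ _ _

lemma image_coreCircle (hF : IsAdaptedLift c T V F) :
    descent F '' coreCircle = Set.range c ×ˢ {0} := by
  ext y
  constructor
  · rintro ⟨q, hq, rfl⟩
    obtain ⟨θ, rfl⟩ := mem_coreCircle_iff.1 hq
    rw [hF.descent_cover, hF.apply_core]
    exact ⟨⟨θ, rfl⟩, rfl⟩
  · rintro ⟨⟨θ, hθ⟩, h2⟩
    refine ⟨cover (θ, 0, 0, 0), mem_coreCircle_iff.2 ⟨θ, rfl⟩, ?_⟩
    rw [hF.descent_cover, hF.apply_core]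
    exact Prod.ext hθ h2.symm

/-- Injectivity on the compact core together with local injectivity at each of its points spreads to
a neighbourhood. -/
lemma exists_injOn (hF : IsAdaptedLift c T V F) (hc : IsRegularLoop c) :
    ∃ U, IsOpen U ∧ coreCircle ⊆ U ∧ Set.InjOn (descent F) U := by
  refine Set.InjOn.exists_isOpen_superset ?_ isCompact_coreCircle ?_ ?_
  · intro q hq q' hq' h
    obtain ⟨θ, rfl⟩ := mem_coreCircle_iff.1 hq
    obtain ⟨θ', rfl⟩ := mem_coreCircle_iff.1 hq'
    rw [hF.descent_cover, hF.descent_cover, hF.apply_core, hF.apply_core] at h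
    exact Prod.ext (Circle.exp_eq_exp.2 (hc.exists_int_of_eq (Prod.mk.inj h).1)) rfl
  · intro q hq
    obtain ⟨θ, rfl⟩ := mem_coreCircle_iff.1 hq
    exact (hF.contMDiffAt_descent (hF.core_mem θ)).continuousAt
  · intro q hq
    obtain ⟨θ, rfl⟩ := mem_coreCircle_iff.1 hq
    obtain ⟨e, he, -, hef, -⟩ := hF.exists_local_inverse (hF.core_mem θ)
    refine ⟨cover '' e.source, ?_, ?_⟩
    · rw [← map_nhds_cover]
      exact Filter.image_mem_map (e.open_source.mem_nhds he)
    · rintro _ ⟨a, ha, rfl⟩ _ ⟨b, hb, rfl⟩ h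
      rw [hF.descent_cover, hF.descent_cover, ← hef] at h
      rw [e.injOn ha hb h]

lemma isOpen_image_cover (hF : IsAdaptedLift c T V F) : IsOpen (cover '' V) := by
  rw [isOpen_iff_mem_nhds]
  rintro _ ⟨p, hp, rfl⟩
  rw [← map_nhds_cover]
  exact Filter.image_mem_map (hF.isOpen.mem_nhds hp)

/-- Points of the twisted torus near the core are images of points of `L₁`. -/
lemma twisted_mem_nhds (hF : IsAdaptedLift c T V F) (hT : IsFibreTwist T) (hc : IsRegularLoop c)
    {Ψ : OpenPartialHomeomorph Ambient (ℂ × ℂ)} (hΨ : (Ψ : Ambient → ℂ × ℂ) = descent F)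
    (hcore : coreCircle ⊆ Ψ.source) (α : ℝ) :
    {x | ∃ q ∈ modelL₁ ∩ Ψ.source, descent F q = pairMap c T x} ∈ nhds (α, α) := by
  have hq : cover (α, 0, 0, 0) ∈ Ψ.source := hcore (mem_coreCircle_iff.2 ⟨α, rfl⟩)
  have hΨq : Ψ (cover (α, 0, 0, 0)) = (c α, 0) := by
    rw [hΨ, hF.descent_cover, hF.apply_core]
  have hpair : pairMap c T (α, α) = (c α, 0) := by
    rw [pairMap_eq_chordMap]
    simp [chordMap_zero hT]
  have ht : (c α, 0) ∈ Ψ.target := hΨq ▸ Ψ.map_source hq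
  have hsymm : Ψ.symm (c α, 0) = cover (α, 0, 0, 0) := by rw [← hΨq, Ψ.left_inv hq]
  have hpc : ContinuousAt (pairMap c T) (α, α) := by
    have := hc.contDiff.continuous
    have := hT.contDiff.continuous
    unfold pairMap midDiff
    fun_prop
  have h1 : ContinuousAt (fun x => Ψ.symm (pairMap c T x)) (α, α) := by
    refine ContinuousAt.comp (g := Ψ.symm) ?_ hpc
    rw [hpair]
    exact Ψ.symm.continuousAt ht
  have h2 : ContinuousAt (fun x => coverSection α (Ψ.symm (pairMap c T x))) (α, α) := by
    refine ContinuousAt.comp (g := coverSection α) ?_ h1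
    rw [hpair, hsymm]
    exact (contMDiffAt_coverSection α (0, 0, 0)).continuousAt
  have h3 : ContinuousAt (fun x : ℝ × ℝ => ((x.1 + x.2) / 2, (x.1 - x.2) / 2)) (α, α) := by
    fun_prop
  -- The lifted preimage and the chord parameters converge jointly to the base point at which
  -- `hF.unique` is available.
  have h4 : Filter.Tendsto (fun x : ℝ × ℝ => (coverSection α (Ψ.symm (pairMap c T x)),
      ((x.1 + x.2) / 2, (x.1 - x.2) / 2))) (nhds (α, α)) (nhds ((α, 0, 0, 0), (α, 0))) := by
    have h := (h2.prodMk h3).tendsto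
    simp only [hpair, hsymm, coverSection_cover, sub_self, zero_div, add_self_div_two] at h
    exact h
  filter_upwards [h4.eventually (hF.unique α),
    hpc.eventually_mem (Ψ.open_target.mem_nhds (hpair ▸ ht))] with x hx hxt
  have hval : descent F (Ψ.symm (pairMap c T x)) = pairMap c T x := by
    rw [← hΨ, Ψ.right_inv hxt]
  refine ⟨Ψ.symm (pairMap c T x), ⟨?_, Ψ.map_target hxt⟩, hval⟩
  refine hx ?_
  rw [← pairMap_eq_chordMap]
  have := congrFun (hF.descent_eq α) (Ψ.symm (pairMap c T x))
  rw [hval] at this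
  exact this.symm

/-- Points of the torus near the core are images of points of `L₀`. -/
lemma torus_mem_nhds (hF : IsAdaptedLift c T V F) {U : Set Ambient} (hU : IsOpen U) (hcore :
    coreCircle ⊆ U) (α : ℝ) :
    {x | ∃ q ∈ {q : Ambient | q.2.2.1 = 0 ∧ q.2.2.2 = 0} ∩ U,
      descent F q = pairMap c id x} ∈ nhds (α, α) := by
  have hcont : Continuous fun x : ℝ × ℝ => cover ((x.1 + x.2) / 2, (x.1 - x.2) / 2, 0, 0) :=
    contMDiff_cover.continuous.comp (by fun_prop)
  have hmem : cover ((α + α) / 2, (α - α) / 2, 0, 0) ∈ U := by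
    rw [sub_self, zero_div]
    exact hcore (mem_coreCircle_iff.2 ⟨_, rfl⟩)
  filter_upwards [hcont.continuousAt.eventually_mem (hU.mem_nhds hmem)] with x hx
  refine ⟨_, ⟨⟨rfl, rfl⟩, hx⟩, ?_⟩
  rw [hF.descent_cover, hF.torus, pairMap_eq_chordMap]
  simp [chordMap]

theorem exists_straightening (hF : IsAdaptedLift c T V F) (hc : IsRegularLoop c) (hT :
    IsFibreTwist T) {ε : ℝ} (hε : 0 < ε) :
    ∃ Ψ : OpenPartialHomeomorph Ambient (ℂ × ℂ),
      IsSymplectomorphism Ψ ∧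
      coreCircle ⊆ Ψ.source ∧ Ψ.source ⊆ modelX ε ∧ Set.range c ×ˢ {0} ⊆ Ψ.target ∧
      Ψ '' coreCircle = Set.range c ×ˢ {0} ∧
      Ψ '' (modelL₀ ε ∩ Ψ.source) = PegModel.torus (Set.range c) ∩ Ψ.target ∧
      (∀ p ∈ Ψ.source, involution p ∈ Ψ.source ∧
        rotation Real.pi (Ψ p) = Ψ (involution p)) ∧
      Ψ '' (modelL₁ ∩ Ψ.source) = Set.range (pairMap c T) ∩ Ψ.target := by
  obtain ⟨U₀, hU₀, hcU₀, hinj⟩ := hF.exists_injOn hc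
  let U₁ : Set Ambient := U₀ ∩ cover '' V ∩ modelX ε
  have hU₁ : IsOpen U₁ := by
    refine (hU₀.inter hF.isOpen_image_cover).inter ?_
    exact isOpen_Ioo.preimage (by fun_prop : Continuous fun p : Ambient => p.2.1)
  have hcU₁ : coreCircle ⊆ U₁ := by
    intro q hq
    refine ⟨⟨hcU₀ hq, ?_⟩, ?_⟩
    · obtain ⟨θ, rfl⟩ := mem_coreCircle_iff.1 hq
      exact ⟨_, hF.core_mem θ, rfl⟩
    · rw [modelX, Set.mem_ofPred_eq, hq.1]
      exact ⟨by linarith, hε⟩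
  -- This preliminary chart supplies the continuous inverse needed in `twisted_mem_nhds`.
  obtain ⟨Ψ₁, -, hsrc₁, hΨ₁⟩ := hF.exists_symplectomorphism hU₁
    (fun q hq => hq.1.2) (hinj.mono fun q hq => hq.1.1)
  obtain ⟨N₀, hN₀, hcN₀, hL₀⟩ := hc.exists_isOpen_pairMap continuous_id (fun w h => h)
    (hF.torus_mem_nhds hU₁ hcU₁)
  obtain ⟨N₁, hN₁, hcN₁, hL₁⟩ := hc.exists_isOpen_pairMap hT.contDiff.continuous hT.eq_zero
    (hF.twisted_mem_nhds hT hc hΨ₁ (hsrc₁ ▸ hcU₁))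
  -- Restricting the image to `N₀ ∩ N₁` excludes the remote parts of both tori; the later
  -- intersection with the preimage under the involution makes the source symmetric.
  let U₂ : Set Ambient := U₁ ∩ descent F ⁻¹' (N₀ ∩ N₁)
  have hcont : ContinuousOn (descent F) U₁ := by
    rw [← hΨ₁, ← hsrc₁]
    exact Ψ₁.continuousOn
  have hU₂ : IsOpen U₂ := hcont.isOpen_inter_preimage hU₁ (hN₀.inter hN₁)
  have hcU₂ : coreCircle ⊆ U₂ := fun q hq => by
    have : descent F q ∈ Set.range c ×ˢ {0} := hF.image_coreCircle ▸ Set.mem_image_of_mem _ hq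
    exact ⟨hcU₁ hq, hcN₀ this, hcN₁ this⟩
  have hcinv : ∀ q ∈ coreCircle, involution q = q := fun q hq =>
    Prod.ext rfl (Prod.ext (by simp [involution, hq.1]) (Prod.ext rfl
      (by simp [involution, hq.2.2])))
  have hcU : coreCircle ⊆ U₂ ∩ involution ⁻¹' U₂ := fun q hq =>
    ⟨hcU₂ hq, by rw [Set.mem_preimage, hcinv q hq]; exact hcU₂ hq⟩
  have hinj₁ : Set.InjOn (descent F) U₁ := hinj.mono fun q hq => hq.1.1
  obtain ⟨Ψ, hΨs, hsrc, hΨ⟩ := hF.exists_symplectomorphism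
    (hU₂.inter (hU₂.preimage continuous_involution)) (fun q hq => hq.1.1.1.2)
    (hinj₁.mono fun q hq => hq.1.1)
  have htgt : Ψ.target = descent F '' (U₂ ∩ involution ⁻¹' U₂) := by
    rw [← Ψ.image_source_eq_target, hsrc, hΨ]
  refine ⟨Ψ, hΨs, ?_⟩
  rw [hsrc, hΨ, htgt]
  refine ⟨hcU, fun q hq => hq.1.1.2, ?_, hF.image_coreCircle, ?_, fun q hq => ?_, ?_⟩
  · rw [← hF.image_coreCircle]
    exact Set.image_mono hcU
  · have htorus : PegModel.torus (Set.range c) = Set.range (pairMap c id) := by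
      rw [← image_torus_eq_range]
      simp
    rw [htorus]
    apply Set.Subset.antisymm
    · rintro _ ⟨q, ⟨hq, hqU⟩, rfl⟩
      refine ⟨?_, q, hqU, rfl⟩
      have hq' : q = cover (Complex.arg q.1, q.2.1, 0, 0) :=
        Prod.ext (Circle.exp_arg q.1).symm (Prod.ext rfl (Prod.ext hq.2.1 hq.2.2))
      rw [hq', hF.descent_cover, hF.torus]
      exact ⟨(_, _), rfl⟩
    · rintro _ ⟨⟨x, hx⟩, q, hq, rfl⟩
      -- The same point of the torus also has a parameter near the diagonal, hence a preimage in
      -- `L₀`; injectivity on `U₁` identifies it with `q`.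
      obtain ⟨x', ⟨q', ⟨hq'L, hq'U⟩, hq'⟩, hxx'⟩ := hL₀ x (hx ▸ hq.1.2.1)
      obtain rfl : q' = q := hinj₁ hq'U hq.1.1 (by rw [hq', hxx', hx])
      exact ⟨q', ⟨⟨hq'U.2, hq'L⟩, hq⟩, rfl⟩
  · refine ⟨⟨hq.2, ?_⟩, (hF.descent_involution q).symm⟩
    rw [Set.mem_preimage, involution_involution]
    exact hq.1
  · apply Set.Subset.antisymm
    · rintro _ ⟨q, ⟨hq, hqU⟩, rfl⟩
      refine ⟨?_, q, hqU, rfl⟩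
      obtain ⟨p, hp, rfl⟩ := hqU.1.1.1.2
      have hp' : p = (p.1, 0, 0, p.2.2.2) :=
        Prod.ext rfl (Prod.ext hq.1 (Prod.ext hq.2 rfl))
      rw [hp'] at hp
      obtain ⟨x, hx⟩ := hF.twisted _ _ hp
      rw [hF.descent_cover, hp', hx, chordMap_eq_pairMap]
      exact ⟨_, rfl⟩
    · rintro _ ⟨⟨x, hx⟩, q, hq, rfl⟩
      obtain ⟨x', ⟨q', ⟨hq'L, hq'U⟩, hq'⟩, hxx'⟩ := hL₁ x (hx ▸ hq.1.2.2)
      rw [hsrc₁] at hq'U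
      obtain rfl : q' = q := hinj₁ hq'U hq.1.1 (by rw [hq', hxx', hx])
      exact ⟨q', ⟨hq'L, hq⟩, rfl⟩

end IsAdaptedLift

end PegModel

end

open PegModel in
theorem mainTheorem4 (γ : Set ℂ) (hγ : IsSmoothJordanCurve γ) (ε : ℝ) (hε : 0 < ε)
    (Lφ : Set (ℂ × ℂ))
    (hLφ : (∃ φ : ℝ, 0 < φ ∧ φ ≤ Real.pi / 2 ∧ Lφ = rotation φ '' torus γ) ∨
      (∃ φ : ℝ → ℝ, ContDiffOn ℝ ∞ φ (Set.Ici 0) ∧ (∀ r, 0 ≤ r → φ r ∈ Set.Ioo 0 Real.pi) ∧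
        ContDiff ℝ ∞ (twist φ) ∧ Lφ = twist φ '' torus γ)) :
    ∃ Ψ : OpenPartialHomeomorph Ambient (ℂ × ℂ),
      IsSymplectomorphism Ψ ∧
      coreCircle ⊆ Ψ.source ∧ Ψ.source ⊆ modelX ε ∧ γ ×ˢ {0} ⊆ Ψ.target ∧
      Ψ '' coreCircle = γ ×ˢ {0} ∧
      Ψ '' (modelL₀ ε ∩ Ψ.source) = torus γ ∩ Ψ.target ∧
      (∀ p ∈ Ψ.source, involution p ∈ Ψ.source ∧
        rotation Real.pi (Ψ p) = Ψ (involution p)) ∧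
      Ψ '' (modelL₁ ∩ Ψ.source) = Lφ ∩ Ψ.target := by
  obtain ⟨c, h1, h2, h3, h4, rfl⟩ := hγ
  have hc : IsRegularLoop c := ⟨h1, h2, h3, h4⟩
  -- In both cases transversality reduces to a nonzero sine of the angle at `w = 0`.
  obtain ⟨T, hT, rfl⟩ : ∃ T : ℂ → ℂ, IsFibreTwist T ∧ Lφ = Set.range (pairMap c T) := by
    rcases hLφ with ⟨φ, h0, hπ, rfl⟩ | ⟨φ, hφ, hφr, ht, rfl⟩
    · have hs : Real.sin φ ≠ 0 :=
        (Real.sin_pos_of_pos_of_lt_pi h0 (by linarith [Real.pi_pos])).ne'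
      exact ⟨_, isFibreTwist_rotation hs, image_torus_eq_range c _⟩
    · have hs : Real.sin (φ 0) ≠ 0 :=
        (Real.sin_pos_of_pos_of_lt_pi (hφr 0 le_rfl).1 (hφr 0 le_rfl).2).ne'
      exact ⟨_, isFibreTwist_twist hφ hs ht,
        image_torus_eq_range c fun w => Complex.exp (φ (2 * ‖w‖) * Complex.I) * w⟩
  obtain ⟨V, F, hF⟩ := exists_isAdaptedLift hc hT
  exact hF.exists_straightening hc hT hε
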